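/- Let $F$ be a non-archimedean locally compact field with residue field $\mathbf{k}_F$ of cardinality $q$ and characteristic $p$, and let $D$ be a central division $F$-algebra of finite dimension $n^2$, with ring of integers $\mathcal{O}_D$ and maximal ideal $\mathfrak{p}_D$. Let $h$ be the Hasse invariant of $D$, that is, the unique integer $h\in\{1,\dots,n\}$ prime to $n$ such that, for a uniformizer $\varpi_D$ of $D$, one has $\varpi_D x\varpi_D^{-1}\equiv x^{q^h} \pmod{\mathfrak{p}_D}$ for all $x\in\mathcal{O}_D$ (it does not depend on the choice of $\varpi_D$). Let $\ell\neq p$ be a prime number and $\overline{\mathbb{F}}_\ell$ an algebraic closure of the field with $\ell$ elements. An $\overline{\mathbb{F}}_\ell$-character of $D^\times$ is a group homomorphism $D^\times\to\overline{\mathbb{F}}_\ell^\times$ with open kernel; it is unramified if it is trivial on $\mathcal{O}_D^\times$. Denote by $1$ the trivial character and by $\mathrm{Ext}^1_{D^\times}$ the first extension group in the category of smooth $\overline{\mathbb{F}}_\ell$-representations of $D^\times$. Then the set of all $\overline{\mathbb{F}}_\ell$-characters $\chi$ of $D^\times$ such that $\mathrm{Ext}^1_{D^\times}(1,\chi)\neq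 0$ is 1. $\{1\}$, if $\ell$ does not divide $q^n-1$; 2. $\{1,\chi_h\}$, if $\ell$ divides $q^n-1$, where $\chi_h$ is the unramified $\overline{\mathbb{F}}_\ell$-character of $D^\times$ that takes the value $q^h$ at any uniformizer of $D$. (The characters $1$ and $\chi_h$ may coincide.) -/

import Mathlib

universe u v

open CategoryTheory ValuativeRel

/-! ### Smooth representations -/

/-- A representation of a topological group is smooth if every vector is fixed by an
open subgroup. -/
def SmoothProp (k : Type u) (G : Type v) [CommRing k] [Group G] [TopologicalSpace G] :
    ObjectProperty (Rep.{u} k G) :=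
  fun V => ∀ x : V, ∃ U : OpenSubgroup G, ∀ g ∈ U, V.ρ g x = x

namespace SmoothProp

variable (k : Type u) (G : Type v) [CommRing k] [Group G] [TopologicalSpace G]

instance closedUnderSubobjects : (SmoothProp k G).IsClosedUnderSubobjects where
  prop_of_mono {X Y} f _ hY x := by
    obtain ⟨U, hU⟩ := hY (f.hom x)
    refine ⟨U, fun g hg => (Rep.mono_iff_injective f).1 inferInstance ?_⟩
    rw [Rep.hom_comm_apply, hU g hg]

instance closedUnderQuotients : (SmoothProp k G).IsClosedUnderQuotients where
  prop_of_epi {X Y} f _ hX y := by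
    obtain ⟨x, rfl⟩ := (Rep.epi_iff_surjective f).1 inferInstance y
    obtain ⟨U, hU⟩ := hX x
    refine ⟨U, fun g hg => ?_⟩
    rw [← Rep.hom_comm_apply, hU g hg]

instance containsZero : (SmoothProp k G).ContainsZero where
  exists_zero := ⟨Rep.trivial k G PUnit, (Rep.isZero_iff _ _ _).2 (inferInstanceAs (Subsingleton PUnit)),
    fun _ => ⟨⊤, fun _ _ => rfl⟩⟩

instance closedUnderBinaryProducts : (SmoothProp k G).IsClosedUnderBinaryProducts where
  limitsOfShape_le := by
    rintro B ⟨p⟩ x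
    let X := p.diag.obj ⟨Limits.WalkingPair.left⟩
    let Y := p.diag.obj ⟨Limits.WalkingPair.right⟩
    let fst : B ⟶ X := p.π.app ⟨Limits.WalkingPair.left⟩
    let snd : B ⟶ Y := p.π.app ⟨Limits.WalkingPair.right⟩
    obtain ⟨U, hU⟩ := p.prop_diag_obj ⟨Limits.WalkingPair.left⟩ (fst.hom x)
    obtain ⟨V, hV⟩ := p.prop_diag_obj ⟨Limits.WalkingPair.right⟩ (snd.hom x)
    refine ⟨U ⊓ V, fun g hg => ?_⟩
    have key : Function.Injective fun b : B => (fst.hom b, snd.hom b) := by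
      let f : B ⟶ X ⊞ Y := fst ≫ Limits.biprod.inl + snd ≫ Limits.biprod.inr
      have hf : Mono f := by
        refine ⟨fun {Z} a b hab => p.isLimit.hom_ext ?_⟩
        have h1 := congrArg (fun t => t ≫ Limits.biprod.fst) hab
        have h2 := congrArg (fun t => t ≫ Limits.biprod.snd) hab
        simp only [f, Preadditive.comp_add, Preadditive.add_comp, Category.assoc,
          Limits.biprod.inl_fst, Limits.biprod.inr_fst, Limits.biprod.inl_snd,
          Limits.biprod.inr_snd, Category.comp_id, Limits.comp_zero, add_zero, zero_add] at h1 h2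
        rintro ⟨_ | _⟩
        · exact h1
        · exact h2
      intro b b' h
      simp only [Prod.mk.injEq] at h
      apply (Rep.mono_iff_injective f).1 hf
      change (Limits.biprod.inl : X ⟶ X ⊞ Y).hom (fst.hom b) +
          (Limits.biprod.inr : Y ⟶ X ⊞ Y).hom (snd.hom b) =
        (Limits.biprod.inl : X ⟶ X ⊞ Y).hom (fst.hom b') +
          (Limits.biprod.inr : Y ⟶ X ⊞ Y).hom (snd.hom b')
      rw [h.1, h.2]
    apply key
    simp only [Prod.mk.injEq]
    exact ⟨by rw [Rep.hom_comm_apply]; exact hU g hg.1,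
      by rw [Rep.hom_comm_apply]; exact hV g hg.2⟩

instance closedUnderFiniteProducts : (SmoothProp k G).IsClosedUnderFiniteProducts :=
  ObjectProperty.IsClosedUnderFiniteProducts.mk'

end SmoothProp

/-- The category `Rep_k(G)` of smooth `k`-linear representations of `G`, with all intertwining
maps as morphisms. It is an abelian category, by the closure properties above. -/
abbrev SmoothRep (k : Type u) (G : Type v) [CommRing k] [Group G] [TopologicalSpace G] :=
  (SmoothProp k G).FullSubcategory

/-- `Ext` groups in `Rep_k(G)` exist in a large enough universe. -/
instance SmoothRep.hasExt (k : Type u) (G : Type v) [CommRing k] [Group G]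
    [TopologicalSpace G] : HasExt.{max (u + 1) v} (SmoothRep k G) := HasExt.standard _

/-- The `k`-characters of `G`: group homomorphisms `G → kˣ` with open kernel. -/
def SmoothCharacter (k : Type u) (G : Type v) [CommRing k] [Group G] [TopologicalSpace G] :
    Type (max u v) :=
  {χ : G →* kˣ // IsOpen (χ.ker : Set G)}

namespace SmoothCharacter

variable {k : Type u} {G : Type v} [CommRing k] [Group G] [TopologicalSpace G]

instance : CoeFun (SmoothCharacter k G) fun _ => G → kˣ := ⟨fun χ => χ.1⟩

/-- The trivial character. -/
instance : One (SmoothCharacter k G) := ⟨⟨1, by simp⟩⟩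

/-- The representation of `G` on the module `k` through the character `χ`. -/
def representation (χ : SmoothCharacter k G) : Representation k G k where
  toFun g := (χ g : k) • LinearMap.id
  map_one' := by ext; simp
  map_mul' g h := by ext; simp [mul_comm]

/-- A character, as an object of the category of smooth representations. -/
def toSmoothRep (χ : SmoothCharacter k G) : SmoothRep k G where
  obj := Rep.of χ.representation
  property x := by
    refine ⟨⟨χ.1.ker, χ.2⟩, fun g hg => ?_⟩
    have hg' : χ.1 g = 1 := hg
    change ((χ.1 g : kˣ) : k) • x = x
    rw [hg']
    simp

end SmoothCharacter

/-! ### Central division algebras over a non-archimedean local field -/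

section DivisionAlgebra

variable (F : Type*) [Field F] [ValuativeRel F] (D : Type*) [DivisionRing D] [Algebra F D]

/-- The reduced degree `n` of a central division algebra `D` over `F`: `[D : F] = n ^ 2`. -/
noncomputable def reducedDegree : ℕ := Nat.sqrt (Module.finrank F D)

variable {D}

/-- The valuation of `D` (written multiplicatively): `x ↦ |N_{D/F}(x)|`, where `|·|` is the
valuation of `F` and `N_{D/F}(x)` is the determinant of `y ↦ x * y` (the `n`-th power of the
reduced norm). Up to equivalence it is the unique valuation of `D` that extends that of `F`. -/
noncomputable def divVal (x : D) : ValueGroupWithZero F := valuation F (Algebra.norm F x)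

variable (D)

/-- The ring of integers `𝒪_D`. -/
def divIntegers : Set D := {x | divVal F x ≤ 1}

/-- The maximal ideal `𝔭_D` of `𝒪_D`. -/
def divMaxIdeal : Set D := {x | divVal F x < 1}

variable {D}

/-- `ϖ` is a uniformizer of `D`: an element of `𝔭_D` of maximal absolute value, that is, a
generator of `𝔭_D`. -/
def IsDivUniformizer (ϖ : Dˣ) : Prop :=
  (ϖ : D) ∈ divMaxIdeal F D ∧ ∀ x ∈ divMaxIdeal F D, divVal F x ≤ divVal F (ϖ : D)

variable (D)

/-- `h` satisfies the defining property of the Hasse invariant of `D`: it is an integer in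
`{1, …, n}` prime to the reduced degree `n`, and conjugation `x ↦ ϖ x ϖ⁻¹` by a uniformizer `ϖ`
of `D` induces on the residue field `𝒪_D / 𝔭_D` the automorphism `x ↦ x ^ (q ^ h)`, where `q` is
the cardinality of the residue field of `F`. -/
def IsHasseInvariant (h : ℕ) : Prop :=
  1 ≤ h ∧ h ≤ reducedDegree F D ∧ h.Coprime (reducedDegree F D) ∧
    ∀ ϖ : Dˣ, IsDivUniformizer F ϖ → ∀ x ∈ divIntegers F D,
      (ϖ : D) * x * ((ϖ⁻¹ : Dˣ) : D) - x ^ (Nat.card 𝓀[F] ^ h) ∈ divMaxIdeal F D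

/-- The Hasse invariant of `D`: the unique `h` with `IsHasseInvariant F D h`. -/
noncomputable def hasseInvariant : ℕ := sInf {h | IsHasseInvariant F D h}

variable {D}

/-- A character of `Dˣ` is unramified if it is trivial on the unit group `𝒪_D^×`, which consists
of the elements of absolute value `1`. -/
def SmoothCharacter.IsUnramified {k : Type*} [CommRing k] [TopologicalSpace D]
    (χ : SmoothCharacter k Dˣ) : Prop :=
  ∀ x : Dˣ, divVal F (x : D) = 1 → χ x = 1

end DivisionAlgebra

/-! ### First extension groups and splitting in an abelian category -/

section ExtOne

open DerivedCategory Pretriangulated Limits TStructure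

universe w'' w' v' u'

variable {C : Type u'} [Category.{v'} C] [Abelian C]

/-- A short complex whose image in the derived category is completed by some `e` to a
distinguished triangle is short exact. -/
lemma shortExact_of_distTriang [HasDerivedCategory.{w'} C] (S : ShortComplex C)
    (e : (singleFunctor C 0).obj S.X₃ ⟶ ((singleFunctor C 0).obj S.X₁)⟦(1 : ℤ)⟧)
    (hT : Triangle.mk ((singleFunctor C 0).map S.f) ((singleFunctor C 0).map S.g) e ∈
      distTriang (DerivedCategory C)) : S.ShortExact := by
  let Φ := singleFunctor C 0 ⋙ homologyFunctor C 0
  let α : Φ ≅ 𝟭 C := singleFunctorCompHomologyFunctorIso C 0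
  -- The outer terms of the long exact homology sequence, `H⁻¹` of `S.X₃` and `H¹` of `S.X₁`,
  -- vanish, so its degree `0` part is short exact.
  have h1 : IsZero ((homologyFunctor C (-1)).obj ((singleFunctor C 0).obj S.X₃)) :=
    isZero_of_isGE _ 0 (-1) (by lia)
  have h2 : IsZero ((homologyFunctor C 1).obj ((singleFunctor C 0).obj S.X₁)) :=
    isZero_of_isLE _ 0 1 (by lia)
  have hm : Mono (Φ.map S.f) :=
    (HomologySequence.mono_homologyMap_mor₁_iff _ hT (-1) 0).2 (h1.eq_of_src _ _)
  have he : Epi (Φ.map S.g) :=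
    (HomologySequence.epi_homologyMap_mor₂_iff _ hT 0 1).2 (h2.eq_of_tgt _ _)
  have hex : (ShortComplex.mk (Φ.map S.f) (Φ.map S.g)
      (by rw [← Φ.map_comp, S.zero]; simp [Φ])).Exact :=
    HomologySequence.exact₂ _ hT 0
  have : (ShortComplex.mk (Φ.map S.f) (Φ.map S.g)
      (by rw [← Φ.map_comp, S.zero]; simp [Φ])).ShortExact := ⟨hex⟩
  exact ShortComplex.shortExact_of_iso
    (ShortComplex.isoMk (α.app _) (α.app _) (α.app _) (by simp) (by simp)) this

/-- Every morphism `X ⟶ Y⟦1⟧` between single objects in the derived category is killed by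
some epimorphism onto `X` with kernel `Y`. -/
lemma exists_shortExact_of_hom_shift [HasDerivedCategory.{w'} C] {X Y : C}
    (e : (singleFunctor C 0).obj X ⟶ ((singleFunctor C 0).obj Y)⟦(1 : ℤ)⟧) :
    ∃ (E : C) (i : Y ⟶ E) (p : E ⟶ X) (w : i ≫ p = 0),
      (ShortComplex.mk i p w).ShortExact ∧ (singleFunctor C 0).map p ≫ e = 0 := by
  -- The middle term of a triangle completing `e` lies in degrees `≤ 0` and `≥ 0`, hence is a single
  -- object.
  obtain ⟨Z, f, g, hT⟩ := distinguished_cocone_triangle₂ e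
  have : t.IsLE Z 0 := t.isLE₂ _ hT 0 (inferInstanceAs (t.IsLE ((singleFunctor C 0).obj Y) 0))
    (inferInstanceAs (t.IsLE ((singleFunctor C 0).obj X) 0))
  have : t.IsGE Z 0 := t.isGE₂ _ hT 0 (inferInstanceAs (t.IsGE ((singleFunctor C 0).obj Y) 0))
    (inferInstanceAs (t.IsGE ((singleFunctor C 0).obj X) 0))
  obtain ⟨E, ⟨φ⟩⟩ := exists_iso_singleFunctor_obj_of_isGE_of_isLE Z 0
  obtain ⟨i, hi⟩ := (singleFunctor C 0).map_surjective (f ≫ φ.hom)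
  obtain ⟨p, hp⟩ := (singleFunctor C 0).map_surjective (φ.inv ≫ g)
  have hT' : Triangle.mk ((singleFunctor C 0).map i) ((singleFunctor C 0).map p) e ∈
      distTriang (DerivedCategory C) := by
    refine isomorphic_distinguished _ hT _
      (Triangle.isoMk _ _ (Iso.refl _) φ.symm (Iso.refl _) ?_ ?_ ?_)
    · change (singleFunctor C 0).map i ≫ φ.inv = 𝟙 ((singleFunctor C 0).obj Y) ≫ f
      simp [hi]
    · change (singleFunctor C 0).map p ≫ 𝟙 ((singleFunctor C 0).obj X) = φ.inv ≫ g
      simp [hp]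
    · change e ≫ (𝟙 ((singleFunctor C 0).obj Y))⟦(1 : ℤ)⟧' = 𝟙 ((singleFunctor C 0).obj X) ≫ e
      simp
  have w : i ≫ p = 0 := (singleFunctor C 0).map_injective (by
    rw [Functor.map_comp, Functor.map_zero]; exact comp_distTriang_mor_zero₁₂ _ hT')
  exact ⟨E, i, p, w, shortExact_of_distTriang (.mk i p w) e hT',
    comp_distTriang_mor_zero₂₃ _ hT'⟩

/-- `Ext¹(X, Y)` vanishes as soon as all extensions of `X` by `Y` split. -/
lemma subsingleton_ext_one_of_split [HasExt.{w''} C] {X Y : C}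
    (h : ∀ (E : C) (i : Y ⟶ E) (p : E ⟶ X) (w : i ≫ p = 0),
      (ShortComplex.mk i p w).ShortExact → ∃ s : X ⟶ E, s ≫ p = 𝟙 X) :
    Subsingleton (Abelian.Ext.{w''} X Y 1) := by
  let := HasDerivedCategory.standard C
  refine subsingleton_of_forall_eq 0 fun e => Abelian.Ext.ext ?_
  obtain ⟨E, i, p, w, hS, he⟩ := exists_shortExact_of_hom_shift e.hom
  obtain ⟨s, hs⟩ := h E i p w hS
  calc e.hom = (singleFunctor C 0).map (s ≫ p) ≫ e.hom := by
        rw [hs, CategoryTheory.Functor.map_id, Category.id_comp]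
    _ = 0 := by rw [Functor.map_comp, Category.assoc, he, comp_zero]
    _ = _ := by rw [Abelian.Ext.zero_hom]

/-- If `Ext¹(X, Y)` vanishes, all extensions of `X` by `Y` split. -/
lemma exists_section_of_subsingleton_ext_one [HasExt.{w''} C] {S : ShortComplex C}
    (hS : S.ShortExact) [Subsingleton (Abelian.Ext.{w''} S.X₃ S.X₁ 1)] :
    ∃ s : S.X₃ ⟶ S.X₂, s ≫ S.g = 𝟙 S.X₃ := by
  -- The obstruction to lifting the identity of `S.X₃` lies in the vanishing `Ext¹`.
  obtain ⟨x, hx⟩ := Abelian.Ext.covariant_sequence_exact₃ S.X₃ hS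
    (Abelian.Ext.mk₀ (𝟙 S.X₃)) (zero_add 1) (Subsingleton.elim _ _)
  obtain ⟨s, rfl⟩ := (Abelian.Ext.mk₀_bijective _ _).2 x
  refine ⟨s, (Abelian.Ext.mk₀_bijective _ _).1 ?_⟩
  rw [← hx, Abelian.Ext.mk₀_comp_mk₀]

end ExtOne

/-! ### Extensions of characters and cocycles -/

namespace SmoothRep

variable {k : Type u} {G : Type v} [CommRing k] [Group G] [TopologicalSpace G]

instance : Limits.PreservesFiniteLimits (SmoothProp k G).ι :=
  have := (SmoothProp k G).preservesKernels_ι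
  Functor.preservesFiniteLimits_of_preservesKernels _

instance : Limits.PreservesFiniteColimits (SmoothProp k G).ι :=
  have := (SmoothProp k G).preservesCokernels_ι
  Functor.preservesFiniteColimits_of_preservesCokernels _

/-- The functor to modules is exact and faithful, so it preserves and detects short exactness. -/
lemma shortExact_iff (S : ShortComplex (SmoothRep k G)) :
    S.ShortExact ↔ Function.Injective S.f.hom.hom ∧ Function.Surjective S.g.hom.hom ∧
      Function.Exact S.f.hom.hom S.g.hom.hom := by
  let Φ := (SmoothProp k G).ι ⋙ forget₂ (Rep.{u} k G) (ModuleCat.{u} k)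
  have hΦ : S.ShortExact ↔ (S.map Φ).ShortExact := by
    refine ⟨fun h => h.map_of_exact Φ, fun h => ?_⟩
    have h1 := h.mono_f
    have h2 := h.epi_g
    exact { exact := (S.exact_map_iff_of_faithful Φ).1 h.exact
            mono_f := Φ.mono_of_mono_map h1
            epi_g := Φ.epi_of_epi_map h2 }
  rw [hΦ]
  constructor
  · intro h
    exact ⟨h.moduleCat_injective_f, h.moduleCat_surjective_g,
      (ShortComplex.ShortExact.moduleCat_exact_iff_function_exact _).1 h.exact⟩
  · rintro ⟨h1, h2, h3⟩
    have := (ModuleCat.mono_iff_injective (S.map Φ).f).2 h1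
    have := (ModuleCat.epi_iff_surjective (S.map Φ).g).2 h2
    exact ⟨(ShortComplex.ShortExact.moduleCat_exact_iff_function_exact _).2 h3⟩

end SmoothRep

namespace SmoothCharacter

variable {k : Type u} {G : Type v} [CommRing k] [Group G] [TopologicalSpace G]

/-- A smooth `1`-cocycle of `G` with values in the character `χ`. -/
structure IsSmoothCocycle (χ : SmoothCharacter k G) (c : G → k) : Prop where
  map_mul (g h : G) : c (g * h) = c g + χ g * c h
  exists_openSubgroup : ∃ U : OpenSubgroup G, ∀ g ∈ U, c g = 0

/-- A `1`-coboundary of `G` with values in the character `χ`. -/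
def IsCoboundary (χ : SmoothCharacter k G) (c : G → k) : Prop :=
  ∃ a : k, ∀ g, c g = χ g * a - a

variable {χ : SmoothCharacter k G} {c : G → k}

lemma representation_apply (χ : SmoothCharacter k G) (g : G) (x : k) :
    χ.representation g x = χ g * x := rfl

lemma IsSmoothCocycle.map_one (hc : χ.IsSmoothCocycle c) : c 1 = 0 := by
  obtain ⟨U, hU⟩ := hc.exists_openSubgroup
  exact hU 1 (one_mem U)

/-- The extension of the trivial character by `χ` defined by a cocycle. -/
def IsSmoothCocycle.extension (hc : χ.IsSmoothCocycle c) : Representation k G (k × k) where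
  toFun g := LinearMap.prod ((χ g : k) • LinearMap.fst k k k + c g • LinearMap.snd k k k)
    (LinearMap.snd k k k)
  map_one' := by ext <;> simp [hc.map_one]
  map_mul' g h := by ext <;> simp [hc.map_mul, add_comm]

lemma IsSmoothCocycle.extension_apply (hc : χ.IsSmoothCocycle c) (g : G) (x : k × k) :
    hc.extension g x = (χ g * x.1 + c g * x.2, x.2) := rfl

/-- The extension defined by a cocycle, as a smooth representation. -/
def IsSmoothCocycle.smoothExtension (hc : χ.IsSmoothCocycle c) : SmoothRep k G where
  obj := Rep.of hc.extension
  property x := by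
    obtain ⟨U, hU⟩ := hc.exists_openSubgroup
    refine ⟨U ⊓ ⟨χ.1.ker, χ.2⟩, fun g hg => ?_⟩
    have hg' : χ.1 g = 1 := hg.2
    change hc.extension g x = x
    rw [hc.extension_apply, hU g hg.1, hg']
    simp

/-- The extension defined by a cocycle, as a short complex. -/
def IsSmoothCocycle.shortComplex (hc : χ.IsSmoothCocycle c) : ShortComplex (SmoothRep k G) where
  X₁ := χ.toSmoothRep
  X₂ := hc.smoothExtension
  X₃ := (1 : SmoothCharacter k G).toSmoothRep
  f := ObjectProperty.homMk (Rep.ofHom (σ := hc.extension) (ρ := χ.representation)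
    ⟨LinearMap.inl k k k, fun g => by
      ext <;> simp [hc.extension_apply, representation_apply]⟩)
  g := ObjectProperty.homMk (Rep.ofHom (ρ := hc.extension)
    (σ := (1 : SmoothCharacter k G).representation)
    ⟨LinearMap.snd k k k, fun g => by
      refine LinearMap.ext fun x => ?_
      change x.2 = ((1 : kˣ) : k) * x.2
      simp⟩)
  zero := by
    ext
    rfl

lemma IsSmoothCocycle.shortComplex_shortExact (hc : χ.IsSmoothCocycle c) :
    hc.shortComplex.ShortExact :=
  (SmoothRep.shortExact_iff _).2 ⟨LinearMap.inl_injective (R := k) (M := k) (M₂ := k),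
    LinearMap.snd_surjective (R := k) (M := k) (M₂ := k),
    Function.Exact.inl_snd (R := k) (M := k) (N := k)⟩

/-- If all cocycles with values in `χ` are coboundaries, then a smooth extension of the trivial
character by `χ` contains a fixed vector that lifts `1`. -/
lemma exists_fixed_lift (h : ∀ c, χ.IsSmoothCocycle c → χ.IsCoboundary c)
    {M : Type*} [AddCommGroup M] [Module k M] (ρ : Representation k G M)
    (hρ : ∀ x : M, ∃ U : OpenSubgroup G, ∀ g ∈ U, ρ g x = x)
    (i : k →ₗ[k] M) (p : M →ₗ[k] k) (hi : Function.Injective i) (hp : Function.Surjective p)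
    (hex : Function.Exact i p) (hic : ∀ g a, i (χ g * a) = ρ g (i a))
    (hpc : ∀ g x, p (ρ g x) = p x) :
    ∃ v, p v = 1 ∧ ∀ g, ρ g v = v := by
  obtain ⟨v, hv⟩ := hp 1
  have hmem : ∀ g, ∃ a : k, i a = ρ g v - v := fun g =>
    (hex _).1 (by rw [map_sub, hpc, sub_self])
  choose c hc using hmem
  have hcc : χ.IsSmoothCocycle c := by
    refine ⟨fun g h => hi ?_, ?_⟩
    · rw [map_add, hic, hc, hc, hc, map_mul, map_sub, Module.End.mul_apply]
      abel
    · obtain ⟨U, hU⟩ := hρ v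
      exact ⟨U, fun g hg => hi (by rw [hc, hU g hg, sub_self, map_zero])⟩
  obtain ⟨a, ha⟩ := h c hcc
  refine ⟨v - i a, by rw [map_sub, hv, hex.apply_apply_eq_zero, sub_zero], fun g => ?_⟩
  have h1 := hc g
  rw [ha g, map_sub, hic] at h1
  rw [map_sub, ← sub_eq_zero, sub_sub_sub_comm, ← h1, sub_self]

/-- A cocycle builds an extension on `k × k`, and a lift of `1` in any extension yields a cocycle.
In both directions, splitting means that the vector over `1` can be corrected to a fixed one. -/
lemma nontrivial_ext_one_iff (χ : SmoothCharacter k G) :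
    Nontrivial (Abelian.Ext (1 : SmoothCharacter k G).toSmoothRep χ.toSmoothRep 1) ↔
      ∃ c, χ.IsSmoothCocycle c ∧ ¬ χ.IsCoboundary c := by
  constructor
  · contrapose!
    intro h
    refine subsingleton_ext_one_of_split fun E i p w hS => ?_
    obtain ⟨hi, hp, hex⟩ := (SmoothRep.shortExact_iff _).1 hS
    obtain ⟨v, hv, hfix⟩ := exists_fixed_lift h E.obj.ρ E.property i.hom.hom.toLinearMap
      p.hom.hom.toLinearMap hi hp hex (fun g a => Rep.hom_comm_apply i.hom g a)
      (fun g x => (Rep.hom_comm_apply p.hom g x).trans (one_mul (M := k) (p.hom.hom x)))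
    refine ⟨ObjectProperty.homMk (Rep.ofHom (ρ := (1 : SmoothCharacter k G).representation)
      (σ := E.obj.ρ) ⟨LinearMap.toSpanSingleton k E.obj v, fun g => ?_⟩), ?_⟩
    · refine LinearMap.ext_ring ?_
      change (((1 : kˣ) : k) * (1 : k)) • v = E.obj.ρ g ((1 : k) • v)
      rw [map_smul, hfix]
      simp
    · refine ObjectProperty.hom_ext _ (Rep.hom_ext ?_)
      refine Representation.IntertwiningMap.ext (LinearMap.ext fun (x : k) => ?_)
      change p.hom.hom.toLinearMap (x • v) = x
      rw [map_smul]
      exact (congrArg (x * ·) hv).trans (mul_one x)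
  · rintro ⟨c, hc, hc'⟩
    by_contra hn
    rw [not_nontrivial_iff_subsingleton] at hn
    apply hc'
    have : Subsingleton (Abelian.Ext hc.shortComplex.X₃ hc.shortComplex.X₁ 1) := hn
    obtain ⟨s, hs⟩ := exists_section_of_subsingleton_ext_one hc.shortComplex_shortExact
    have hs1 : hc.shortComplex.g.hom.hom (s.hom.hom (1 : k)) = (1 : k) :=
      congrArg (fun f => f.hom.hom (1 : k)) hs
    let x : k × k := s.hom.hom (1 : k)
    have hx2 : x.2 = 1 := hs1
    have hx (g : G) : x = hc.extension g x := by
      have := Rep.hom_comm_apply s.hom g (1 : k)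
      refine Eq.trans ?_ this
      change s.hom.hom (1 : k) = s.hom.hom (((1 : kˣ) : k) * (1 : k) : k)
      simp
    -- The section sends `1` to a fixed vector `(x.1, 1)`, so `x.1 = χ(g) x.1 + c(g)`.
    refine ⟨-x.1, fun g => ?_⟩
    have h1 := congrArg Prod.fst (hx g)
    rw [hc.extension_apply, hx2] at h1
    linear_combination -h1

end SmoothCharacter

/-! ### Cocycles on a group with a unit filtration -/

/-- A topological group with a valuation `ord`, an element `ϖ` of valuation `1` and a filtration that
behaves like the one by principal unit groups of the multiplicative group of a division algebra over
a local field of residue characteristic `p`. -/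
structure UnitFiltration (G : Type v) [Group G] [TopologicalSpace G] (p : ℕ) where
  U : ℕ → Subgroup G
  normal (j : ℕ) : (U j).Normal
  isOpen (j : ℕ) : IsOpen (U j : Set G)
  exists_le (V : OpenSubgroup G) : ∃ j, U j ≤ V.toSubgroup
  commutator_mem (j : ℕ) {x y : G} (hx : x ∈ U j) (hy : y ∈ U j) :
    x * y * x⁻¹ * y⁻¹ ∈ U (j + 1)
  pow_mem (j : ℕ) {x : G} (hx : x ∈ U (j + 1)) : x ^ p ∈ U (j + 2)
  ord : G →* Multiplicative ℤ
  mem_zero_iff (x : G) : x ∈ U 0 ↔ ord x = 1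
  antitone : Antitone U
  ϖ : G
  ord_ϖ : ord ϖ = Multiplicative.ofAdd 1

namespace SmoothCharacter

variable {k : Type u} {G : Type v} [Field k] [Group G] [TopologicalSpace G]

lemma one_apply (g : G) : (1 : SmoothCharacter k G) g = 1 := rfl

namespace IsSmoothCocycle

variable {χ : SmoothCharacter k G} {c : G → k}

lemma map_inv (hc : χ.IsSmoothCocycle c) (g : G) : χ g * c g⁻¹ = - c g := by
  have := hc.map_mul g g⁻¹
  rw [mul_inv_cancel, hc.map_one] at this
  linear_combination -this

lemma map_conj (hc : χ.IsSmoothCocycle c) (g x : G) (hx : χ x = 1) :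
    c (g * x * g⁻¹) = χ g * c x := by
  rw [hc.map_mul, hc.map_mul, MonoidHom.map_mul, hx, mul_one, hc.map_inv]
  ring

lemma map_pow (hc : χ.IsSmoothCocycle c) {x : G} (hx : χ x = 1) (m : ℕ) :
    c (x ^ m) = m * c x := by
  induction m with
  | zero => simp [hc.map_one]
  | succ m ih =>
    rw [pow_succ, hc.map_mul, ih, MonoidHom.map_pow, hx]
    push_cast
    simp
    ring

lemma sub_coboundary (hc : χ.IsSmoothCocycle c) (a : k) :
    χ.IsSmoothCocycle fun g => c g - (χ g * a - a) := by
  refine ⟨fun g h => ?_, ?_⟩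
  · rw [hc.map_mul, MonoidHom.map_mul, Units.val_mul]
    ring
  · obtain ⟨V, hV⟩ := hc.exists_openSubgroup
    refine ⟨V ⊓ ⟨χ.1.ker, χ.2⟩, fun g hg => ?_⟩
    have hg' : χ.1 g = 1 := hg.2
    rw [hV g hg.1, hg']
    simp

/-- The zero locus of a cocycle. -/
def zeroLocus (hc : χ.IsSmoothCocycle c) : Subgroup G where
  carrier := {g | c g = 0}
  mul_mem' {a b} ha hb := by
    change c (a * b) = 0
    rw [hc.map_mul, ha, hb, mul_zero, add_zero]
  one_mem' := hc.map_one
  inv_mem' {a} ha := by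
    have := hc.map_inv a
    rw [show c a = 0 from ha, neg_zero] at this
    exact (mul_eq_zero.1 this).resolve_left (χ a).ne_zero

lemma mem_zeroLocus (hc : χ.IsSmoothCocycle c) (g : G) : g ∈ hc.zeroLocus ↔ c g = 0 := Iff.rfl

/-- A cocycle that vanishes on a normal subgroup on which `χ` is nontrivial is zero. -/
lemma eq_zero_of_normal (hc : χ.IsSmoothCocycle c) (N : Subgroup G) [N.Normal]
    (hN : ∀ x ∈ N, c x = 0) {n : G} (hn : n ∈ N) (hχ : χ n ≠ 1) (g : G) : c g = 0 := by
  -- Evaluating `c` on both sides gives `χ(n)c(g) = c(g)`.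
  have h1 : n * g = g * (g⁻¹ * n * g) := by group
  have h2 : g⁻¹ * n * g ∈ N := by
    simpa using Subgroup.Normal.conj_mem inferInstance n hn g⁻¹
  have h3 := congrArg c h1
  rw [hc.map_mul, hc.map_mul, hN n hn, hN _ h2] at h3
  have h4 : ((χ n : k) - 1) * c g = 0 := by linear_combination h3
  refine (mul_eq_zero.1 h4).resolve_left fun h => hχ (Units.ext ?_)
  simpa [sub_eq_zero] using h

section Filtration

variable {p : ℕ} (F : UnitFiltration G p) (hp : (p : k) ≠ 0)

-- The powers `x ^ p ^ m` eventually enter an open subgroup on which `c` is zero, while `c (x ^ p ^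
-- m) = p ^ m * c x` with `p` invertible.
include hp in
lemma eq_zero_of_mem (hc : χ.IsSmoothCocycle c) (j : ℕ) (hj : ∀ x ∈ F.U (j + 1), χ x = 1)
    {x : G} (hx : x ∈ F.U (j + 1)) : c x = 0 := by
  obtain ⟨V, hV⟩ := hc.exists_openSubgroup
  obtain ⟨m, hm⟩ := F.exists_le V
  have key : ∀ i : ℕ, x ^ p ^ i ∈ F.U (j + i + 1) := by
    intro i
    induction i with
    | zero => simpa using hx
    | succ i ih =>
      rw [pow_succ, pow_mul]
      exact F.pow_mem _ ih
  have h1 : c (x ^ p ^ m) = 0 := hV _ (hm (F.antitone (by lia) (key m)))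
  rw [hc.map_pow (hj x hx), Nat.cast_pow] at h1
  exact (mul_eq_zero.1 h1).resolve_left (pow_ne_zero m hp)

/-- Subtract a coboundary so that the new cocycle `c'` vanishes at `x`. For `y` in `U j`, the
products `xy` and `yx` differ by an element of `U (j + 1)`, which is invisible to `c'`. Hence
`χ(x)c'(y) = c'(y)` and `c'(y) = 0`. Since `U j` is normal and `χ` is nontrivial on it, `c'`
vanishes everywhere. -/
lemma isCoboundary_of_commutator (hc : χ.IsSmoothCocycle c) (j : ℕ)
    (hj : ∀ x ∈ F.U (j + 1), χ x = 1) (hcj : ∀ x ∈ F.U (j + 1), c x = 0) {x : G}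
    (hx : x ∈ F.U j) (hχ : χ x ≠ 1) : χ.IsCoboundary c := by
  have hne : (χ x : k) - 1 ≠ 0 := fun h => hχ (Units.ext (by simpa [sub_eq_zero] using h))
  let a := c x / (χ x - 1)
  have hc' := hc.sub_coboundary a
  have hx0 : c x - (χ x * a - a) = 0 := by
    simp only [a]
    field_simp
    ring
  have := F.normal j
  refine ⟨a, fun g => sub_eq_zero.1 (hc'.eq_zero_of_normal (F.U j) (fun y hy => ?_) hx hχ g)⟩
  have h1 : x * y = (y * x) * (x⁻¹ * y⁻¹ * x⁻¹⁻¹ * y⁻¹⁻¹) := by group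
  have h2 := F.commutator_mem j (inv_mem hx) (inv_mem hy)
  have h3 : c (x * y) - (χ (x * y) * a - a) = _ :=
    congrArg (fun g => c g - (χ g * a - a)) h1
  rw [hc'.map_mul, hc'.map_mul (y * x), hc'.map_mul y x, hx0, hcj _ h2, hj _ h2] at h3
  have h4 : ((χ x : k) - 1) * (c y - (χ y * a - a)) = 0 := by
    simp at h3
    linear_combination h3
  exact (mul_eq_zero.1 h4).resolve_left hne

-- Take the least `j` with `χ` trivial on `U j`. If it were positive, the commutator argument one
-- level above would make `c` a coboundary.
include hp in
lemma trivial_on_units (hc : χ.IsSmoothCocycle c) (hcb : ¬ χ.IsCoboundary c) :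
    ∀ x ∈ F.U 0, χ x = 1 := by
  classical
  have hex : ∃ j, ∀ x ∈ F.U j, χ x = 1 := by
    obtain ⟨j, hj⟩ := F.exists_le ⟨χ.1.ker, χ.2⟩
    exact ⟨j, fun x hx => hj hx⟩
  rcases h0 : Nat.find hex with _ | j
  · exact h0 ▸ Nat.find_spec hex
  · exfalso
    have hj := Nat.find_spec hex
    rw [h0] at hj
    have hmin := Nat.find_min hex (m := j) (by lia)
    push Not at hmin
    obtain ⟨x, hx, hχ⟩ := hmin
    exact hcb (hc.isCoboundary_of_commutator F j hj
      (fun y hy => hc.eq_zero_of_mem F hp j hj hy) hx hχ)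

end Filtration

end IsSmoothCocycle

end SmoothCharacter

/-- A finite cyclic group of order divisible by `ℓ` has a nontrivial additive character with values
in a field of characteristic `ℓ`. -/
lemma exists_hom_ne_one_of_dvd_card {k : Type*} [Field k] {C : Type*} [CommGroup C] [IsCyclic C]
    (ℓ : ℕ) [Fact ℓ.Prime] [CharP k ℓ] (hℓ : ℓ ∣ Nat.card C) :
    ∃ (f : C →* Multiplicative k) (x : C), f x ≠ 1 := by
  let f₁ : ZMod (Nat.card C) →+ k :=
    ((ZMod.castHom (dvd_refl ℓ) k).comp (ZMod.castHom hℓ (ZMod ℓ))).toAddMonoidHom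
  let e : Multiplicative (ZMod (Nat.card C)) ≃* C := zmodCyclicMulEquiv inferInstance
  refine ⟨(AddMonoidHom.toMultiplicative f₁).comp e.symm.toMonoidHom, e (Multiplicative.ofAdd 1),
    fun h => ?_⟩
  have h1 : f₁ 1 = 0 := by simpa using congrArg Multiplicative.toAdd h
  have h2 : f₁ 1 = 1 := map_one ((ZMod.castHom (dvd_refl ℓ) k).comp (ZMod.castHom hℓ (ZMod ℓ)))
  exact one_ne_zero (h2.symm.trans h1)

namespace UnitFiltration

open SmoothCharacter

variable {k : Type u} {G : Type v} [Field k] [Group G] [TopologicalSpace G] {p : ℕ}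
  (F : UnitFiltration G p)

lemma mul_ϖ_zpow_mem (g : G) : g * F.ϖ ^ (-(F.ord g).toAdd) ∈ F.U 0 := by
  rw [F.mem_zero_iff, map_mul, map_zpow, F.ord_ϖ, ← ofAdd_zsmul]
  simp [ofAdd_neg]

lemma eq_top_of_mem {H : Subgroup G} (h0 : F.U 0 ≤ H) (hϖ : F.ϖ ∈ H) (g : G) : g ∈ H := by
  have h1 := H.mul_mem (h0 (F.mul_ϖ_zpow_mem g)) (H.zpow_mem hϖ (F.ord g).toAdd)
  simpa using h1

lemma character_ext {χ ψ : SmoothCharacter k G} (h0 : ∀ x ∈ F.U 0, χ x = 1)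
    (h0' : ∀ x ∈ F.U 0, ψ x = 1) (hϖ : χ F.ϖ = ψ F.ϖ) : χ = ψ :=
  Subtype.ext (MonoidHom.ext fun g => F.eq_top_of_mem (H := MonoidHom.eqLocus χ.1 ψ.1)
    (fun x hx => (h0 x hx).trans (h0' x hx).symm) hϖ g)

/-- The unramified character with given value at the uniformizer. -/
def unramifiedCharacter [IsTopologicalGroup G] (a : kˣ) : SmoothCharacter k G :=
  ⟨(zpowersHom kˣ a).comp F.ord, Subgroup.isOpen_mono (H₁ := F.U 0)
    (fun x hx => by
      have := (F.mem_zero_iff x).1 hx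
      simp [MonoidHom.mem_ker, this]) (F.isOpen 0)⟩

lemma unramifiedCharacter_apply [IsTopologicalGroup G] (a : kˣ) (g : G) :
    F.unramifiedCharacter a g = a ^ (F.ord g).toAdd := rfl

lemma unramifiedCharacter_of_mem [IsTopologicalGroup G] (a : kˣ) {g : G} (hg : g ∈ F.U 0) :
    F.unramifiedCharacter a g = 1 := by
  rw [unramifiedCharacter_apply, (F.mem_zero_iff g).1 hg]
  simp

lemma unramifiedCharacter_ϖ [IsTopologicalGroup G] (a : kˣ) : F.unramifiedCharacter a F.ϖ = a := by
  rw [unramifiedCharacter_apply, F.ord_ϖ]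
  simp

variable (hp : (p : k) ≠ 0) {C : Type*} [CommGroup C] (r : F.U 0 →* C)
  (hr : ∀ u, r u = 1 ↔ (u : G) ∈ F.U 1) {s : ℕ}
  (hs : ∀ u : F.U 0, ∃ h, r ⟨F.ϖ * u * F.ϖ⁻¹, h⟩ = r u ^ s)

-- Here `χ` is trivial on `U 0` and `c` on `U 1`, so `c` restricted to `U 0` is an additive
-- character through `C`. The two alternatives are that this restriction is zero or not.
include hp hr hs in
lemma eq_one_or_of_cocycle [Finite C] {χ : SmoothCharacter k G} {c : G → k}
    (hc : χ.IsSmoothCocycle c) (hcb : ¬ χ.IsCoboundary c) :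
    χ = 1 ∨ (Nat.card C : k) = 0 ∧ (∀ x ∈ F.U 0, χ x = 1) ∧ (χ F.ϖ : k) = s := by
  have h0 := hc.trivial_on_units F hp hcb
  have h1 : ∀ x ∈ F.U 1, c x = 0 := fun x hx =>
    hc.eq_zero_of_mem F hp 0 (fun y hy => h0 y (F.antitone zero_le_one hy)) hx
  by_cases h : ∀ x ∈ F.U 0, c x = 0
  · left
    by_contra hχ
    have hϖ : (χ F.ϖ : k) - 1 ≠ 0 := fun hϖ => hχ (F.character_ext h0 (fun _ _ => rfl)
      (Units.ext (by simpa [sub_eq_zero, one_apply] using hϖ)))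
    -- This choice makes the corrected cocycle vanish at `ϖ`. Its zero locus is then a subgroup
    -- containing `U 0` and `ϖ`, hence everything.
    let a := c F.ϖ / (χ F.ϖ - 1)
    have hc' := hc.sub_coboundary a
    refine hcb ⟨a, fun g => sub_eq_zero.1 (F.eq_top_of_mem (H := hc'.zeroLocus) ?_ ?_ g)⟩
    · intro x hx
      rw [hc'.mem_zeroLocus, h x hx, h0 x hx]
      simp
    · rw [hc'.mem_zeroLocus]
      simp only [a]
      field_simp
      ring
  · right
    push Not at h
    obtain ⟨x, hx, hcx⟩ := h
    refine ⟨?_, h0, ?_⟩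
    · have h2 : x ^ Nat.card C ∈ F.U 1 := (hr (⟨x, hx⟩ ^ Nat.card C)).1 (by
        rw [map_pow, pow_card_eq_one'])
      have h3 := h1 _ h2
      rw [hc.map_pow (h0 x hx)] at h3
      exact (mul_eq_zero.1 h3).resolve_right hcx
    · obtain ⟨hm, hxs⟩ := hs ⟨x, hx⟩
      have h2 : (F.ϖ * x * F.ϖ⁻¹) * (x ^ s)⁻¹ ∈ F.U 1 :=
        (hr (⟨_, hm⟩ * (⟨x, hx⟩ ^ s)⁻¹)).1 (by
          rw [map_mul, map_inv, map_pow, hxs, mul_inv_cancel])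
      have h3 := h1 _ h2
      have h4 : c (F.ϖ * x * F.ϖ⁻¹) = c (x ^ s) := by
        have h5 := hc.map_mul ((F.ϖ * x * F.ϖ⁻¹) * (x ^ s)⁻¹) (x ^ s)
        rw [inv_mul_cancel_right, h3, h0 _ (F.antitone zero_le_one h2)] at h5
        simpa using h5
      rw [hc.map_conj _ _ (h0 x hx), hc.map_pow (h0 x hx)] at h4
      exact mul_right_cancel₀ hcx h4

-- The valuation is an additive character, with value `1 ≠ 0` at `ϖ`, whereas coboundaries of the
-- trivial character are zero.
include F in
lemma exists_cocycle_one :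
    ∃ c, (1 : SmoothCharacter k G).IsSmoothCocycle c ∧
      ¬ (1 : SmoothCharacter k G).IsCoboundary c := by
  refine ⟨fun g => ((F.ord g).toAdd : k), ⟨fun g h => ?_, ⟨F.U 0, F.isOpen 0⟩, fun g hg => ?_⟩, ?_⟩
  · simp [one_apply]
  · have := (F.mem_zero_iff g).1 hg
    simp [this]
  · rintro ⟨a, ha⟩
    have := ha F.ϖ
    simp [F.ord_ϖ, one_apply] at this

-- Write `g = u ϖ^i` with `u` in `U 0` and put `c(g) = f(r(u))`, where `f` is a nonzero additive
-- character of `C`. The condition `χ(ϖ) = s` is what makes this a cocycle. It is not a coboundary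
-- because coboundaries vanish on `U 0`, where `χ` is trivial.
include hr hs in
lemma exists_cocycle_of_dvd [Finite C] [IsCyclic C] (hsurj : Function.Surjective r) (ℓ : ℕ)
    [Fact ℓ.Prime] [CharP k ℓ] (hℓ : ℓ ∣ Nat.card C) {χ : SmoothCharacter k G}
    (h0 : ∀ x ∈ F.U 0, χ x = 1) (hϖ : (χ F.ϖ : k) = s) :
    ∃ c, χ.IsSmoothCocycle c ∧ ¬ χ.IsCoboundary c := by
  obtain ⟨f, x, hf⟩ := exists_hom_ne_one_of_dvd_card (k := k) (C := C) ℓ hℓ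
  obtain ⟨u, rfl⟩ := hsurj x
  have hN := F.normal 0
  let d : F.U 0 → k := fun u => (f (r u)).toAdd
  have hd (u v : F.U 0) : d (u * v) = d u + d v := by simp [d]
  let conj (g : G) (u : F.U 0) : F.U 0 := ⟨g * u * g⁻¹, hN.conj_mem u u.2 g⟩
  have hdϖ (u : F.U 0) : d (conj F.ϖ u) = χ F.ϖ * d u := by
    obtain ⟨_, hu⟩ := hs u
    simp only [d, conj]
    rw [hu, hϖ]
    simp
  -- Equivariance under `ϖ` passes to all its powers; negative ones use that `χ(ϖ)` is invertible.
  have hdz (i : ℤ) : ∀ u : F.U 0, d (conj (F.ϖ ^ i) u) = (χ (F.ϖ ^ i) : k) * d u := by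
    induction i with
    | zero => intro u; simp [conj]
    | succ i ih =>
      intro u
      have h1 : conj (F.ϖ ^ ((i : ℤ) + 1)) u = conj (F.ϖ ^ (i : ℤ)) (conj F.ϖ u) :=
        Subtype.ext (by simp only [conj, zpow_add_one]; group)
      rw [h1, ih, hdϖ, zpow_add_one, MonoidHom.map_mul, Units.val_mul, mul_assoc]
    | pred i ih =>
      intro u
      have h1 : conj F.ϖ (conj (F.ϖ ^ (-(i : ℤ) - 1)) u) = conj (F.ϖ ^ (-(i : ℤ))) u :=
        Subtype.ext (by simp only [conj, zpow_sub_one]; group)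
      have h2 := hdϖ (conj (F.ϖ ^ (-(i : ℤ) - 1)) u)
      rw [h1, ih] at h2
      have h3 : χ (F.ϖ ^ (-(i : ℤ))) = χ F.ϖ * χ (F.ϖ ^ (-(i : ℤ) - 1)) := by
        rw [← MonoidHom.map_mul]
        congr 1
        group
      rw [h3, Units.val_mul, mul_assoc] at h2
      exact (mul_left_cancel₀ (χ F.ϖ).ne_zero h2).symm
  let P (g : G) : F.U 0 := ⟨_, F.mul_ϖ_zpow_mem g⟩
  have hχ (g : G) : χ (F.ϖ ^ (F.ord g).toAdd) = χ g := by
    have h1 := h0 _ (F.mul_ϖ_zpow_mem g)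
    rw [MonoidHom.map_mul, zpow_neg, MonoidHom.map_inv, mul_inv_eq_one] at h1
    exact h1.symm
  have hP1 (v : F.U 0) : P v = v := Subtype.ext (by
    simp only [P]
    rw [(F.mem_zero_iff v).1 v.2]
    simp)
  refine ⟨fun g => d (P g), ⟨fun g h => ?_, ⟨⟨F.U 1, F.isOpen 1⟩, fun g hg => ?_⟩⟩, ?_⟩
  · have h1 : P (g * h) = P g * conj (F.ϖ ^ (F.ord g).toAdd) (P h) := Subtype.ext (by
      simp only [P, conj, Subgroup.coe_mul, map_mul, toAdd_mul, neg_add, zpow_add]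
      group)
    change d (P (g * h)) = d (P g) + χ g * d (P h)
    rw [h1, hd, hdz, hχ]
  · have h2 := (hr ⟨g, F.antitone zero_le_one hg⟩).2 hg
    have h3 : P g = ⟨g, F.antitone zero_le_one hg⟩ := hP1 ⟨g, F.antitone zero_le_one hg⟩
    change d (P g) = 0
    rw [h3]
    simp [d, h2]
  · rintro ⟨a, ha⟩
    have h1 : d (P u) = χ u * a - a := ha u
    rw [hP1, h0 _ u.2] at h1
    refine hf (Multiplicative.toAdd.injective ?_)
    simpa [d] using h1

include hp hr hs in
lemma setOf_nontrivial_ext [Finite C] [IsCyclic C] (hsurj : Function.Surjective r) (ℓ : ℕ)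
    [Fact ℓ.Prime] [CharP k ℓ] :
    (¬ ℓ ∣ Nat.card C → {χ : SmoothCharacter k G | Nontrivial (Abelian.Ext
        (1 : SmoothCharacter k G).toSmoothRep χ.toSmoothRep 1)} = {1}) ∧
    (ℓ ∣ Nat.card C → ∀ χ₀ : SmoothCharacter k G, (∀ x ∈ F.U 0, χ₀ x = 1) →
      (χ₀ F.ϖ : k) = s → {χ : SmoothCharacter k G | Nontrivial (Abelian.Ext
        (1 : SmoothCharacter k G).toSmoothRep χ.toSmoothRep 1)} = {1, χ₀}) := by
  simp_rw [nontrivial_ext_one_iff]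
  constructor
  · intro hℓ
    refine Set.Subset.antisymm ?_ ?_
    · rintro χ ⟨c, hc, hcb⟩
      rcases F.eq_one_or_of_cocycle hp r hr hs hc hcb with h | ⟨h, -⟩
      · exact h
      · exact absurd ((CharP.cast_eq_zero_iff k ℓ _).1 h) hℓ
    · rintro _ rfl
      exact F.exists_cocycle_one
  · intro hℓ χ₀ h0 hϖ
    refine Set.Subset.antisymm ?_ ?_
    · rintro χ ⟨c, hc, hcb⟩
      rcases F.eq_one_or_of_cocycle hp r hr hs hc hcb with h | ⟨-, h, h'⟩
      · exact Or.inl h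
      · exact Or.inr (F.character_ext h h0 (Units.ext (h'.trans hϖ.symm)))
    · rintro _ (rfl | rfl)
      · exact F.exists_cocycle_one
      · exact F.exists_cocycle_of_dvd r hr hs hsurj ℓ hℓ h0 hϖ

end UnitFiltration

/-! ### Balls and compact sets in the local field -/

section LocalField

variable {F : Type*} [Field F] [ValuativeRel F] [TopologicalSpace F]
  [IsNonarchimedeanLocalField F]

open Topology

lemma setOf_valuation_lt_mem_nhds (x : F) {γ : ValueGroupWithZero F} (hγ : γ ≠ 0) :
    {y | valuation F (y - x) < γ} ∈ 𝓝 x :=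
  (IsValuativeTopology.hasBasis_nhds' x).mem_of_mem hγ

lemma isOpen_setOf_valuation_lt (γ : ValueGroupWithZero F) :
    IsOpen {x : F | valuation F x < γ} := by
  refine isOpen_iff_mem_nhds.2 fun x hx => ?_
  have hγ : γ ≠ 0 := (zero_le.trans_lt hx).ne'
  filter_upwards [setOf_valuation_lt_mem_nhds x hγ] with y hy
  have := (valuation F).map_add (y - x) x
  rw [sub_add_cancel] at this
  exact this.trans_lt (max_lt hy hx)

lemma isOpen_setOf_valuation_le {γ : ValueGroupWithZero F} (hγ : γ ≠ 0) :
    IsOpen {x : F | valuation F x ≤ γ} := by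
  refine isOpen_iff_mem_nhds.2 fun x hx => ?_
  filter_upwards [setOf_valuation_lt_mem_nhds x hγ] with y hy
  have := (valuation F).map_add (y - x) x
  rw [sub_add_cancel] at this
  exact this.trans (max_le hy.le hx)

lemma isClosed_setOf_valuation_le (γ : ValueGroupWithZero F) :
    IsClosed {x : F | valuation F x ≤ γ} := by
  refine ⟨isOpen_iff_mem_nhds.2 fun x hx => ?_⟩
  have hx' : γ < valuation F x := not_le.1 hx
  filter_upwards [setOf_valuation_lt_mem_nhds x (zero_le.trans_lt hx').ne'] with y hy
  have : valuation F y = valuation F x := by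
    simpa using Valuation.map_add_eq_of_lt_left (valuation F) hy
  simpa [this] using hx'

lemma exists_valuation_le_of_isCompact {K : Set F} (hK : IsCompact K) :
    ∃ γ : ValueGroupWithZero F, ∀ x ∈ K, valuation F x ≤ γ := by
  refine hK.induction_on (p := fun K => ∃ γ : ValueGroupWithZero F, ∀ x ∈ K, valuation F x ≤ γ)
    ⟨0, by simp⟩ (fun s t hst ⟨γ, h⟩ => ⟨γ, fun x hx => h x (hst hx)⟩) ?_ ?_
  · rintro s t ⟨γ, h⟩ ⟨δ, h'⟩
    refine ⟨max γ δ, ?_⟩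
    rintro x (hx | hx)
    · exact (h x hx).trans (le_max_left _ _)
    · exact (h' x hx).trans (le_max_right _ _)
  · intro x hx
    refine ⟨_, mem_nhdsWithin_of_mem_nhds (setOf_valuation_lt_mem_nhds x one_ne_zero),
      max 1 (valuation F x), fun y hy => ?_⟩
    have := (valuation F).map_add (y - x) x
    rw [sub_add_cancel] at this
    exact this.trans (max_le_max (le_of_lt hy) le_rfl)

end LocalField

/-! ### The valuation of the division algebra -/

section DivisionAlgebra

variable (F : Type*) [Field F] [ValuativeRel F] {D : Type*} [DivisionRing D] [Algebra F D]

lemma divVal_mul (x y : D) : divVal F (x * y) = divVal F x * divVal F y := by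
  simp [divVal]

lemma divVal_one : divVal F (1 : D) = 1 := by
  simp [divVal]

variable [FiniteDimensional F D]

lemma divVal_algebraMap (a : F) :
    divVal F (algebraMap F D a) = valuation F a ^ Module.finrank F D := by
  simp [divVal, Algebra.norm_algebraMap]

lemma divVal_eq_zero_iff {x : D} : divVal F x = 0 ↔ x = 0 := by
  refine ⟨fun h => ?_, fun h => ?_⟩
  · by_contra hx
    have := divVal_mul F x x⁻¹
    rw [mul_inv_cancel₀ hx, divVal_one, h, zero_mul] at this
    exact one_ne_zero this
  · have := divVal_algebraMap F (D := D) 0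
    rwa [map_zero, map_zero, zero_pow Module.finrank_pos.ne', ← h] at this

variable [TopologicalSpace F] [IsNonarchimedeanLocalField F] [TopologicalSpace D]
  [IsModuleTopology F D]

lemma continuous_algebraNorm : Continuous (Algebra.norm F : D → F) := by
  have h (x : D) := Algebra.norm_eq_matrix_det (Module.finBasis F D) x
  have h1 : Continuous (Algebra.leftMulMatrix (Module.finBasis F D)) :=
    IsModuleTopology.continuous_of_linearMap
      (Algebra.leftMulMatrix (Module.finBasis F D)).toLinearMap
  rw [funext h]
  exact h1.matrix_det

omit [FiniteDimensional F D] in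
lemma continuous_equivFun {ι : Type*} [Finite ι] (b : Module.Basis ι F D) :
    Continuous b.equivFun :=
  IsModuleTopology.continuous_of_linearMap b.equivFun.toLinearMap

omit [FiniteDimensional F D] in
lemma continuous_equivFun_symm {ι : Type*} [Finite ι] (b : Module.Basis ι F D) :
    Continuous b.equivFun.symm :=
  have := IsModuleTopology.toContinuousAdd F D
  have := IsModuleTopology.toContinuousSMul F D
  IsModuleTopology.continuous_of_linearMap b.equivFun.symm.toLinearMap

omit [FiniteDimensional F D] in
lemma isCompact_setOf_equivFun {ι : Type*} [Finite ι] (b : Module.Basis ι F D)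
    (γ : ValueGroupWithZero F) : IsCompact {x : D | ∀ i, valuation F (b.equivFun x i) ≤ γ} := by
  have h1 : IsCompact (Set.pi Set.univ fun _ : ι => {x : F | valuation F x ≤ γ}) :=
    isCompact_univ_pi fun _ => IsNonarchimedeanLocalField.isCompact_closedBall F γ
  convert! h1.image (continuous_equivFun_symm F b) using 1
  ext x
  constructor
  · intro hx
    exact ⟨b.equivFun x, fun i _ => hx i, b.equivFun.symm_apply_apply x⟩
  · rintro ⟨f, hf, rfl⟩ i
    simpa using hf i trivial

/-- An integral element of `D` has bounded coordinates. -/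
lemma exists_valuation_equivFun_le {ι : Type*} [Finite ι] (b : Module.Basis ι F D) :
    ∃ γ : ValueGroupWithZero F, 1 ≤ γ ∧ ∀ x : D, divVal F x ≤ 1 →
      ∀ i, valuation F (b.equivFun x i) ≤ γ := by
  -- The unit sphere of the sup norm: it is compact and the norm has no zero on it, so the inverse
  -- of the norm is bounded there. Dividing `x` by its largest coordinate `a` lands in `S` and
  -- bounds `|a| ^ [D : F]`.
  let S : Set D := {x | ∀ i, valuation F (b.equivFun x i) ≤ 1} ∩
    ⋃ i, {x | valuation F (b.equivFun x i) < 1}ᶜ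
  have hS : IsCompact S := by
    refine (isCompact_setOf_equivFun F b 1).inter_right (isClosed_iUnion_of_finite fun i => ?_)
    exact ((isOpen_setOf_valuation_lt 1).preimage
      ((continuous_apply i).comp (continuous_equivFun F b))).isClosed_compl
  have hne : ∀ x ∈ S, Algebra.norm F x ≠ 0 := by
    rintro x ⟨-, hx⟩ h0
    have h1 : x = 0 := (divVal_eq_zero_iff F).1 (by rw [divVal, h0, map_zero])
    obtain ⟨i, hi⟩ := Set.mem_iUnion.1 hx
    apply hi
    simp [h1]
  have hcont : ContinuousOn (fun x : D => (Algebra.norm F x)⁻¹) S :=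
    (continuous_algebraNorm F).continuousOn.inv₀ hne
  obtain ⟨γ, hγ⟩ := exists_valuation_le_of_isCompact (hS.image_of_continuousOn hcont)
  refine ⟨max γ 1, le_max_right _ _, fun x hx i => ?_⟩
  have : Nonempty ι := ⟨i⟩
  obtain ⟨j, hj⟩ := Finite.exists_max fun i => valuation F (b.equivFun x i)
  refine (hj i).trans ?_
  by_cases h1 : valuation F (b.equivFun x j) ≤ 1
  · exact h1.trans (le_max_right _ _)
  push Not at h1
  set a := b.equivFun x j with ha
  have ha0 : a ≠ 0 := by
    intro h
    rw [h, map_zero] at h1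
    exact not_lt_zero h1
  have hva : valuation F a ≠ 0 := (map_ne_zero _).2 ha0
  have hcoord (i : ι) : valuation F (b.equivFun (a⁻¹ • x) i) =
      (valuation F a)⁻¹ * valuation F (b.equivFun x i) := by
    rw [map_smul, Pi.smul_apply, smul_eq_mul, map_mul, map_inv₀]
  have hy : a⁻¹ • x ∈ S := by
    refine ⟨fun i => ?_, Set.mem_iUnion.2 ⟨j, ?_⟩⟩
    · rw [hcoord, inv_mul_le_iff₀ (zero_lt_iff.2 hva), mul_one]
      exact hj i
    · change ¬ valuation F (b.equivFun (a⁻¹ • x) j) < 1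
      rw [hcoord, inv_mul_cancel₀ hva]
      exact lt_irrefl _
  have h2 := hγ _ ⟨_, hy, rfl⟩
  rw [map_inv₀] at h2
  change (divVal F (a⁻¹ • x))⁻¹ ≤ γ at h2
  rw [Algebra.smul_def, divVal_mul, divVal_algebraMap, map_inv₀, mul_inv, inv_pow, inv_inv] at h2
  have hx0 : divVal F x ≠ 0 := by
    rw [Ne, divVal_eq_zero_iff]
    rintro rfl
    exact ha0 (by simp [ha])
  have h3 : valuation F a ^ Module.finrank F D ≤ γ := by
    refine le_trans ?_ h2
    exact le_mul_of_one_le_right zero_le ((one_le_inv₀ (zero_lt_iff.2 hx0)).2 hx)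
  exact ((le_self_pow₀ h1.le Module.finrank_pos.ne').trans h3).trans (le_max_left _ _)

/-- This is the ultrametric inequality in disguise. Powers of `x` have bounded coordinates and
binomial coefficients are integral, so all `(1 + x)^m` stay in one compact set. Thus `|1 + x|^m` is
bounded in `m`, which excludes `|1 + x| > 1`. -/
lemma divVal_one_add_le {x : D} (hx : divVal F x ≤ 1) : divVal F (1 + x) ≤ 1 := by
  let b := Module.finBasis F D
  obtain ⟨γ, -, hγ⟩ := exists_valuation_equivFun_le F b
  obtain ⟨δ, hδ⟩ := exists_valuation_le_of_isCompact
    ((isCompact_setOf_equivFun F b γ).image (continuous_algebraNorm F))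
  have hpow (m : ℕ) : divVal F (x ^ m) ≤ 1 := by
    induction m with
    | zero => rw [pow_zero, divVal_one]
    | succ m ih => rw [pow_succ, divVal_mul]; exact mul_le_one' ih hx
  have hbound (m : ℕ) : divVal F ((1 + x) ^ m) ≤ δ := by
    refine hδ _ ⟨_, fun i => ?_, rfl⟩
    rw [(Commute.one_left x).add_pow, map_sum, Finset.sum_apply]
    refine (valuation F).map_sum_le fun j _ => ?_
    have h1 : (1 : D) ^ j * x ^ (m - j) * (m.choose j : D) =
        ((m.choose j : ℕ) : F) • x ^ (m - j) := by
      rw [one_pow, one_mul, Algebra.smul_def, map_natCast, (Nat.cast_commute _ _).eq]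
    rw [h1, map_smul, Pi.smul_apply, smul_eq_mul, map_mul]
    have h2 : valuation F ((m.choose j : ℕ) : F) ≤ 1 :=
      natCast_mem (valuation F).integer _
    exact (mul_le_of_le_one_left' h2).trans (hγ _ (hpow _) i)
  have hpow' (m : ℕ) : divVal F ((1 + x) ^ m) = divVal F (1 + x) ^ m := by
    induction m with
    | zero => rw [pow_zero, pow_zero, divVal_one]
    | succ m ih => rw [pow_succ, divVal_mul, ih, pow_succ]
  by_contra! h
  obtain ⟨m, hm⟩ := MulArchimedean.arch δ h
  have h3 := hbound (m + 1)
  rw [hpow', pow_succ] at h3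
  have h4 : 0 < divVal F (1 + x) ^ m := pow_pos (zero_lt_one.trans h) m
  exact absurd (h3.trans hm) (not_le.2 (lt_mul_of_one_lt_right h4 h))

variable (D) in
/-- `divVal` as a valuation. -/
noncomputable def divValuation : Valuation D (ValueGroupWithZero F) where
  toFun := divVal F
  map_zero' := (divVal_eq_zero_iff F).2 rfl
  map_one' := divVal_one F
  map_mul' := divVal_mul F
  map_add_le_max' := by
    have key (x y : D) (h : divVal F x ≤ divVal F y) : divVal F (x + y) ≤ divVal F y := by
      by_cases hy : y = 0
      · rw [hy, add_zero, ← hy]; exact h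
      · have hy' : 0 < divVal F y := zero_lt_iff.2 fun h => hy ((divVal_eq_zero_iff F).1 h)
        have h1 : x + y = (1 + x * y⁻¹) * y := by
          rw [add_mul, one_mul, mul_assoc, inv_mul_cancel₀ hy, mul_one, add_comm]
        have h2 : divVal F (x * y⁻¹) ≤ 1 := by
          have h3 : divVal F (x * y⁻¹) * divVal F y = divVal F x := by
            rw [← divVal_mul, mul_assoc, inv_mul_cancel₀ hy, mul_one]
          rw [← h3] at h
          exact (mul_le_iff_le_one_left hy').1 h
        rw [h1, divVal_mul]
        exact mul_le_of_le_one_left' (divVal_one_add_le F h2)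
    intro x y
    rcases le_total (divVal F x) (divVal F y) with h | h
    · exact (key x y h).trans (le_max_right _ _)
    · rw [add_comm]
      exact (key y x h).trans (le_max_left _ _)

lemma divValuation_apply (x : D) : divValuation F D x = divVal F x := rfl

lemma divVal_add_le {x y : D} {γ : ValueGroupWithZero F} (hx : divVal F x ≤ γ)
    (hy : divVal F y ≤ γ) : divVal F (x + y) ≤ γ :=
  (divValuation F D).map_add_le hx hy

lemma isClosed_setOf_divVal_le (γ : ValueGroupWithZero F) : IsClosed {x : D | divVal F x ≤ γ} :=
  (isClosed_setOf_valuation_le γ).preimage (continuous_algebraNorm F)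

lemma isOpen_setOf_divVal_le {γ : ValueGroupWithZero F} (hγ : γ ≠ 0) :
    IsOpen {x : D | divVal F x ≤ γ} :=
  (isOpen_setOf_valuation_le hγ).preimage (continuous_algebraNorm F)

variable (D) in
lemma isCompact_divIntegers : IsCompact (divIntegers F D) := by
  let b := Module.finBasis F D
  obtain ⟨γ, -, hγ⟩ := exists_valuation_equivFun_le F b
  exact (isCompact_setOf_equivFun F b γ).of_isClosed_subset (isClosed_setOf_divVal_le F 1) hγ

variable (D) in
omit [TopologicalSpace D] [IsModuleTopology F D] in
lemma exists_isDivUniformizer : ∃ ϖ : Dˣ, IsDivUniformizer F ϖ := by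
  let e := IsNonarchimedeanLocalField.valueGroupWithZeroIsoInt F
  have he0 {x : D} (hx : x ≠ 0) : e (divVal F x) ≠ 0 :=
    (map_ne_zero e).2 fun h => hx ((divVal_eq_zero_iff F).1 h)
  -- With the value group identified with `ℤ`, a uniformizer realizes the greatest negative value.
  let P : ℤ → Prop := fun n => ∃ x : D, x ≠ 0 ∧ (e (divVal F x)).log = n ∧ n < 0
  have hlog {x : D} (hx : x ≠ 0) : (e (divVal F x)).log < 0 ↔ divVal F x < 1 := by
    rw [← map_lt_map_iff e, map_one, ← WithZero.log_one,
      WithZero.log_lt_log (he0 hx) one_ne_zero]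
  have hP : ∃ z, P z := by
    obtain ⟨a, ha0, ha⟩ := Valuation.IsNontrivial.exists_lt_one (v := valuation F)
    have ha0' : algebraMap F D a ≠ 0 := (map_ne_zero _).2 ha0
    refine ⟨_, algebraMap F D a, ha0', rfl, ?_⟩
    rw [hlog ha0', divVal_algebraMap]
    exact pow_lt_one₀ zero_le ha Module.finrank_pos.ne'
  have hbdd : ∃ b, ∀ z, P z → z ≤ b := by
    refine ⟨0, ?_⟩
    rintro z ⟨_, _, _, h⟩
    exact h.le
  obtain ⟨n, ⟨x, hx, hxn, hn⟩, hmax⟩ := Int.exists_greatest_of_bdd hbdd hP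
  refine ⟨Units.mk0 x hx, (hlog hx).1 (hxn ▸ hn), fun y hy => ?_⟩
  by_cases hy0 : y = 0
  · rw [(divVal_eq_zero_iff F).2 hy0]
    exact zero_le
  · have h1 := hmax _ ⟨y, hy0, rfl, (hlog hy0).2 hy⟩
    rw [← hxn, WithZero.log_le_log (he0 hy0) (he0 hx), map_le_map_iff] at h1
    exact h1

end DivisionAlgebra

section Uniformizer

variable {F : Type*} [Field F] [ValuativeRel F] {D : Type*} [DivisionRing D] [Algebra F D]

lemma divVal_pow (x : D) (m : ℕ) : divVal F (x ^ m) = divVal F x ^ m := by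
  simp [divVal]

lemma divVal_inv (x : Dˣ) : divVal F ((x⁻¹ : Dˣ) : D) = (divVal F (x : D))⁻¹ := by
  refine eq_inv_of_mul_eq_one_left ?_
  rw [← divVal_mul, Units.inv_mul, divVal_one]

lemma divVal_zpow (x : Dˣ) (i : ℤ) :
    divVal F ((x ^ i : Dˣ) : D) = divVal F (x : D) ^ i := by
  cases i with
  | ofNat i => simp [divVal_pow]
  | negSucc i => rw [zpow_negSucc, divVal_inv, zpow_negSucc, Units.val_pow_eq_pow_val, divVal_pow]

lemma divVal_conj (x : Dˣ) (y : D) : divVal F (x * y * ((x⁻¹ : Dˣ) : D)) = divVal F y := by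
  rw [divVal_mul, divVal_mul, mul_right_comm, ← divVal_mul, Units.mul_inv, divVal_one, one_mul]

variable [FiniteDimensional F D]

lemma divVal_unit_ne_zero (x : Dˣ) : divVal F (x : D) ≠ 0 := by
  rw [Ne, divVal_eq_zero_iff]
  exact x.ne_zero

lemma divVal_unit_pos (x : Dˣ) : 0 < divVal F (x : D) := zero_lt_iff.2 (divVal_unit_ne_zero x)

omit [FiniteDimensional F D] in
lemma IsDivUniformizer.of_divVal_eq {ϖ ϖ' : Dˣ} (hϖ : IsDivUniformizer F ϖ)
    (h : divVal F (ϖ' : D) = divVal F (ϖ : D)) : IsDivUniformizer F ϖ' :=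
  ⟨h.trans_lt hϖ.1, fun x hx => (hϖ.2 x hx).trans_eq h.symm⟩

omit [FiniteDimensional F D] in
lemma IsDivUniformizer.divVal_eq {ϖ ϖ' : Dˣ} (hϖ : IsDivUniformizer F ϖ)
    (hϖ' : IsDivUniformizer F ϖ') : divVal F (ϖ : D) = divVal F (ϖ' : D) :=
  le_antisymm (hϖ'.2 _ hϖ.1) (hϖ.2 _ hϖ'.1)

namespace IsDivUniformizer

variable {ϖ : Dˣ} (hϖ : IsDivUniformizer F ϖ)

include hϖ

omit [FiniteDimensional F D] in
lemma lt_one_iff_le {x : D} : divVal F x < 1 ↔ divVal F x ≤ divVal F (ϖ : D) :=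
  ⟨fun h => hϖ.2 x h, fun h => h.trans_lt hϖ.1⟩

omit [FiniteDimensional F D] in
lemma divVal_lt_one : divVal F (ϖ : D) < 1 := hϖ.1

lemma lt_zpow_iff {x : D} {i : ℤ} :
    divVal F x < divVal F (ϖ : D) ^ i ↔ divVal F x ≤ divVal F (ϖ : D) ^ (i + 1) := by
  have h0 := divVal_unit_pos (F := F) ϖ
  have h1 : divVal F x = divVal F (x * ((ϖ ^ (-i) : Dˣ) : D)) * divVal F (ϖ : D) ^ i := by
    rw [divVal_mul, divVal_zpow, mul_assoc, ← zpow_add₀ h0.ne', neg_add_cancel, zpow_zero, mul_one]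
  rw [h1, zpow_add₀ h0.ne', zpow_one, mul_comm _ (divVal F (ϖ : D)),
    mul_le_mul_iff_of_pos_right (zpow_pos h0 i), mul_lt_iff_lt_one_left (zpow_pos h0 i),
    hϖ.lt_one_iff_le]

lemma zpow_strictAnti : StrictAnti fun i : ℤ => divVal F (ϖ : D) ^ i :=
  zpow_right_strictAnti₀ (divVal_unit_pos ϖ) hϖ.divVal_lt_one

variable [TopologicalSpace F] [IsNonarchimedeanLocalField F]

lemma exists_pow_le {γ : ValueGroupWithZero F} (hγ : γ ≠ 0) :
    ∃ i : ℕ, divVal F (ϖ : D) ^ i ≤ γ := by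
  obtain ⟨i, hi⟩ := MulArchimedean.arch γ⁻¹
    ((one_lt_inv₀ (divVal_unit_pos (F := F) ϖ)).2 hϖ.divVal_lt_one)
  refine ⟨i, ?_⟩
  rwa [inv_pow, inv_le_inv₀ (zero_lt_iff.2 hγ) (pow_pos (divVal_unit_pos ϖ) i)] at hi

lemma eq_zero_of_forall_le {x : D} (h : ∀ i : ℕ, divVal F x ≤ divVal F (ϖ : D) ^ i) : x = 0 := by
  by_contra hx
  obtain ⟨i, hi⟩ := hϖ.exists_pow_le (γ := divVal F x) fun h => hx ((divVal_eq_zero_iff F).1 h)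
  exact absurd ((h (i + 1)).trans' hi) (not_le.2
    (pow_lt_pow_right_of_lt_one₀ (divVal_unit_pos ϖ) hϖ.divVal_lt_one (lt_add_one i)))

/-- Every nonzero element has the valuation of a power of the uniformizer. -/
lemma exists_eq_zpow (x : Dˣ) : ∃ i : ℤ, divVal F (x : D) = divVal F (ϖ : D) ^ i := by
  have h0 := divVal_unit_pos (F := F) ϖ
  have hx := divVal_unit_pos (F := F) x
  have hbdd : ∃ b : ℤ, ∀ z : ℤ, divVal F (x : D) ≤ divVal F (ϖ : D) ^ z → z ≤ b := by
    obtain ⟨i, hi⟩ := hϖ.exists_pow_le hx.ne'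
    exact ⟨i, fun z hz => hϖ.zpow_strictAnti.le_iff_ge.1 (by simpa using hi.trans hz)⟩
  have hex : ∃ z : ℤ, divVal F (x : D) ≤ divVal F (ϖ : D) ^ z := by
    obtain ⟨i, hi⟩ := hϖ.exists_pow_le (inv_ne_zero hx.ne')
    refine ⟨-i, ?_⟩
    rw [zpow_neg, zpow_natCast]
    exact (le_inv_comm₀ (pow_pos h0 i) hx).1 hi
  obtain ⟨i, hi, hmax⟩ := Int.exists_greatest_of_bdd hbdd hex
  refine ⟨i, hi.eq_or_lt.resolve_right fun h => ?_⟩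
  have := hmax _ (hϖ.lt_zpow_iff.1 h)
  lia

lemma exists_eq_pow {x : D} (hx : x ≠ 0) (h : divVal F x ≤ 1) :
    ∃ i : ℕ, divVal F x = divVal F (ϖ : D) ^ i := by
  obtain ⟨i, hi⟩ := hϖ.exists_eq_zpow (Units.mk0 x hx)
  rw [Units.val_mk0] at hi
  have hi0 : 0 ≤ i := by
    rw [hi, ← zpow_zero (divVal F (ϖ : D))] at h
    exact hϖ.zpow_strictAnti.le_iff_ge.1 h
  obtain ⟨j, rfl⟩ := Int.eq_ofNat_of_zero_le hi0
  exact ⟨j, by simpa using hi⟩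

/-- The balls are compact and decrease to `{0}`, so one of them lies inside any given neighbourhood
of `0`. -/
lemma exists_setOf_divVal_le_subset [TopologicalSpace D] [IsModuleTopology F D] {V : Set D}
    (hV : V ∈ nhds 0) : ∃ i : ℕ, {x : D | divVal F x ≤ divVal F (ϖ : D) ^ i} ⊆ V := by
  have hanti : Antitone fun i : ℕ => {x : D | divVal F x ≤ divVal F (ϖ : D) ^ i} :=
    fun i j hij x (hx : divVal F x ≤ _) =>
      hx.trans (pow_le_pow_of_le_one zero_le hϖ.divVal_lt_one.le hij)
  refine exists_subset_nhds_of_isCompact' (directed_of_isDirected_le hanti)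
    (fun i => (isCompact_divIntegers F D).of_isClosed_subset (isClosed_setOf_divVal_le F _)
      fun x hx => ?_) (fun i => isClosed_setOf_divVal_le F _) fun x hx => ?_
  · exact hx.out.trans (pow_le_one₀ zero_le hϖ.divVal_lt_one.le)
  · have : x = 0 := hϖ.eq_zero_of_forall_le fun i => Set.mem_iInter.1 hx i
    rwa [this]

end IsDivUniformizer

end Uniformizer

/-! ### Lattices and indices of balls -/

section Lattice

/-- The quotient of a lattice over a discrete valuation ring by the maximal ideal. -/
lemma natCard_quotient_maximalIdeal_smul_top {R K V : Type*} [CommRing R] [IsDomain R]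
    [IsDiscreteValuationRing R] [Field K] [Algebra R K] [IsFractionRing R K] [AddCommGroup V]
    [Module R V] [Module K V] [IsScalarTower R K V] [FiniteDimensional K V] (M : Submodule R V)
    (hM : M.IsLattice K) :
    Nat.card (M ⧸ (IsLocalRing.maximalIdeal R • (⊤ : Submodule R M))) =
      Nat.card (IsLocalRing.ResidueField R) ^ Module.finrank K V := by
  have : Module.Free R M := Submodule.IsLattice.free K M
  have : Module.Finite R M := Submodule.IsLattice.finite K M
  have h1 : Module.finrank R M = Module.finrank K V :=
    congrArg Cardinal.toNat (Submodule.IsLattice.rank' K M)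
  rw [← h1, ← Module.finrank_baseChange (R := IsLocalRing.ResidueField R) (S := R),
    ← Module.natCard_eq_pow_finrank (K := IsLocalRing.ResidueField R)]
  exact (Nat.card_congr
    (TensorProduct.quotTensorEquivQuotSMul M (IsLocalRing.maximalIdeal R)).toEquiv).symm

end Lattice

section Balls

variable (F : Type*) [Field F] [ValuativeRel F] (D : Type*) [DivisionRing D] [Algebra F D]
  [FiniteDimensional F D] [TopologicalSpace F] [IsNonarchimedeanLocalField F]
  [TopologicalSpace D] [IsModuleTopology F D]

/-- The closed ball of radius `γ` in `D`. -/
noncomputable def divBall (γ : ValueGroupWithZero F) : AddSubgroup D where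
  carrier := {x | divVal F x ≤ γ}
  add_mem' := divVal_add_le F
  zero_mem' := by
    rw [Set.mem_ofPred, (divVal_eq_zero_iff F).2 rfl]
    exact zero_le
  neg_mem' {x} hx := by
    rw [Set.mem_ofPred, ← divValuation_apply, Valuation.map_neg]
    exact hx

variable {F D} in
lemma mem_divBall {γ : ValueGroupWithZero F} {x : D} : x ∈ divBall F D γ ↔ divVal F x ≤ γ := Iff.rfl

/-- The ring of integers as a lattice. -/
noncomputable def divLattice : Submodule 𝒪[F] D where
  __ := divBall F D 1
  smul_mem' a x hx := by
    change divVal F ((a : F) • x) ≤ 1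
    rw [Algebra.smul_def, divVal_mul, divVal_algebraMap]
    exact mul_le_one' (pow_le_one₀ zero_le a.2) hx

lemma divLattice_isLattice : (divLattice F D).IsLattice F where
  fg := by
    let b := Module.finBasis F D
    obtain ⟨γ, hγ1, hγ⟩ := exists_valuation_equivFun_le F b
    obtain ⟨c, rfl⟩ := valuation_surjective γ
    have hc : c ≠ 0 := by
      rintro rfl
      rw [map_zero] at hγ1
      exact not_lt_zero (zero_lt_one.trans_le hγ1)
    have hle : divLattice F D ≤ Submodule.span 𝒪[F] (Set.range fun i => c • b i) := by
      intro x hx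
      rw [← b.sum_equivFun x]
      refine Submodule.sum_mem _ fun i _ => ?_
      have h1 : valuation F (c⁻¹ * b.equivFun x i) ≤ 1 := by
        rw [map_mul, map_inv₀, inv_mul_le_iff₀ (zero_lt_iff.2 ((map_ne_zero _).2 hc)), mul_one]
        exact hγ x hx i
      have h2 : b.equivFun x i • b i = (⟨_, h1⟩ : 𝒪[F]) • c • b i := by
        change _ = (c⁻¹ * b.equivFun x i) • c • b i
        rw [smul_smul, mul_right_comm, inv_mul_cancel₀ hc, one_mul]
      rw [h2]
      exact Submodule.smul_mem _ _ (Submodule.subset_span ⟨i, rfl⟩)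
    have := isNoetherian_span_of_finite 𝒪[F] (Set.finite_range fun i => c • b i)
    have := isNoetherian_of_le hle
    exact (isNoetherian_submodule.1 this) _ le_rfl
  span_eq_top := by
    refine eq_top_iff.2 fun x _ => ?_
    suffices h : ∃ a : F, a ≠ 0 ∧ divVal F (a • x) ≤ 1 by
      obtain ⟨a, ha, hax⟩ := h
      rw [← inv_smul_smul₀ ha x]
      exact Submodule.smul_mem _ _ (Submodule.subset_span hax)
    rcases le_or_gt (divVal F x) 1 with h | h
    · exact ⟨1, one_ne_zero, by rwa [one_smul]⟩
    · obtain ⟨a, ha⟩ := valuation_surjective (divVal F x)⁻¹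
      have h0 : 0 < divVal F x := zero_lt_one.trans h
      refine ⟨a, fun h0' => ?_, ?_⟩
      · rw [h0', map_zero] at ha
        exact inv_ne_zero h0.ne' ha.symm
      · rw [Algebra.smul_def, divVal_mul, divVal_algebraMap, ha, ← inv_mul_cancel₀ h0.ne']
        exact mul_le_mul_left (pow_le_of_le_one zero_le ((inv_le_one₀ h0).2 h.le)
          Module.finrank_pos.ne') _

variable {F D} {ϖ : Dˣ} (hϖ : IsDivUniformizer F ϖ)

/-- Left multiplication by `ϖ ^ j` carries the first two balls to this pair. -/
lemma relIndex_divBall_succ (j : ℕ) :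
    (divBall F D (divVal F (ϖ : D) ^ (j + 1))).relIndex (divBall F D (divVal F (ϖ : D) ^ j)) =
      (divBall F D (divVal F (ϖ : D))).relIndex (divBall F D 1) := by
  have h (i : ℕ) : divBall F D (divVal F (ϖ : D) ^ (i + j)) =
      (divBall F D (divVal F (ϖ : D) ^ i)).map (AddMonoidHom.mulLeft ((ϖ : D) ^ j)) := by
    ext x
    rw [AddSubgroup.mem_map, mem_divBall]
    constructor
    · intro hx
      refine ⟨((ϖ : D) ^ j)⁻¹ * x, ?_, mul_inv_cancel_left₀ (pow_ne_zero j ϖ.ne_zero) x⟩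
      rw [mem_divBall, ← mul_le_mul_iff_of_pos_left (pow_pos (divVal_unit_pos (F := F) ϖ) j),
        ← divVal_pow, ← divVal_mul, mul_inv_cancel_left₀ (pow_ne_zero j ϖ.ne_zero), divVal_pow,
        ← pow_add, add_comm]
      exact hx
    · rintro ⟨y, hy, rfl⟩
      rw [AddMonoidHom.coe_mulLeft, divVal_mul, divVal_pow, add_comm, pow_add]
      exact mul_le_mul_right hy _
  have h1 := h 1
  have h0 := h 0
  rw [zero_add] at h0
  rw [add_comm j 1, h1, h0, AddSubgroup.relIndex_map_map_of_injective, pow_one, pow_zero]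
  exact mul_right_injective₀ (pow_ne_zero j ϖ.ne_zero)

include hϖ in
lemma relIndex_divBall_pow (j : ℕ) :
    (divBall F D (divVal F (ϖ : D) ^ j)).relIndex (divBall F D 1) =
      (divBall F D (divVal F (ϖ : D))).relIndex (divBall F D 1) ^ j := by
  induction j with
  | zero => rw [pow_zero, pow_zero, AddSubgroup.relIndex_self]
  | succ j ih =>
    rw [← AddSubgroup.relIndex_mul_relIndex _ (divBall F D (divVal F (ϖ : D) ^ j)) _
      (fun x (hx : divVal F x ≤ _) => hx.trans (pow_le_pow_of_le_one zero_le hϖ.divVal_lt_one.le j.le_succ))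
      (fun x (hx : divVal F x ≤ _) => hx.trans (pow_le_one₀ zero_le hϖ.divVal_lt_one.le)),
      relIndex_divBall_succ, ih, pow_succ, mul_comm]

/-- The smaller ball is `π𝒪_D`, and `𝒪_D` is an `𝒪_F`-lattice of rank `[D : F]`. -/
lemma relIndex_divBall_irreducible {π : 𝒪[F]} (hπ : Irreducible π) :
    (divBall F D (divVal F (algebraMap F D π))).relIndex (divBall F D 1) =
      Nat.card 𝓀[F] ^ Module.finrank F D := by
  rw [← natCard_quotient_maximalIdeal_smul_top _ (divLattice_isLattice F D)]
  let f : divLattice F D →+ D := (divLattice F D).subtype.toAddMonoidHom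
  have hf : f.range = divBall F D 1 := by
    ext x
    exact ⟨fun ⟨y, hy⟩ => hy ▸ y.2, fun hx => ⟨⟨x, hx⟩, rfl⟩⟩
  have hπ0 : algebraMap F D π ≠ 0 :=
    (map_ne_zero _).2 fun h => hπ.ne_zero (Subtype.ext h)
  have hcomap : (divBall F D (divVal F (algebraMap F D π))).comap f =
      (IsLocalRing.maximalIdeal 𝒪[F] • (⊤ : Submodule 𝒪[F] (divLattice F D))).toAddSubgroup := by
    ext x
    rw [hπ.maximalIdeal_eq, Submodule.ideal_span_singleton_smul, AddSubgroup.mem_comap,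
      Submodule.mem_toAddSubgroup, Submodule.mem_smul_pointwise_iff_exists, mem_divBall]
    have h0 : 0 < divVal F (algebraMap F D π) :=
      zero_lt_iff.2 fun h => hπ0 ((divVal_eq_zero_iff F).1 h)
    constructor
    · intro hx
      have h1 : divVal F ((algebraMap F D π)⁻¹ * x) ≤ 1 := by
        rw [← mul_le_mul_iff_of_pos_left h0, ← divVal_mul, mul_inv_cancel_left₀ hπ0, mul_one]
        exact hx
      refine ⟨⟨_, h1⟩, trivial, Subtype.ext ?_⟩
      change (π : F) • ((algebraMap F D π)⁻¹ * (x : D)) = x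
      rw [Algebra.smul_def, mul_inv_cancel_left₀ hπ0]
    · rintro ⟨y, -, rfl⟩
      change divVal F ((π : F) • (y : D)) ≤ _
      rw [Algebra.smul_def, divVal_mul]
      exact mul_le_of_le_one_right' y.2
  rw [← hf, ← AddSubgroup.index_comap, hcomap]
  rfl

end Balls

/-! ### The residue field and ramification -/

section ResidueField

variable (F : Type*) [Field F] [ValuativeRel F] (D : Type*) [DivisionRing D] [Algebra F D]
  [FiniteDimensional F D] [TopologicalSpace F] [IsNonarchimedeanLocalField F]
  [TopologicalSpace D] [IsModuleTopology F D]

/-- The ring of integers of `D`. -/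
noncomputable abbrev divRing : Subring D := (divValuation F D).integer

/-- The maximal ideal of the ring of integers of `D`. -/
noncomputable def divRingMax : Ideal (divRing F D) where
  carrier := {x | divVal F (x : D) < 1}
  add_mem' {x y} hx hy := (divValuation F D).map_add_lt hx hy
  zero_mem' := by
    change divVal F (0 : D) < 1
    rw [(divVal_eq_zero_iff F).2 rfl]
    exact zero_lt_one
  smul_mem' a x hx := by
    change divVal F ((a : D) * x) < 1
    rw [divVal_mul]
    exact (mul_le_of_le_one_left' a.2).trans_lt hx

variable {F D} in
lemma mem_divRingMax {x : divRing F D} : x ∈ divRingMax F D ↔ divVal F (x : D) < 1 := Iff.rfl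

instance : (divRingMax F D).IsTwoSided where
  mul_mem_of_left {x} y hx := by
    rw [mem_divRingMax, Subring.coe_mul, divVal_mul]
    exact (mul_le_of_le_one_right' y.2).trans_lt hx

/-- The residue ring of `D`. -/
abbrev divResidue : Type _ := divRing F D ⧸ divRingMax F D

namespace divResidue

instance : IsDomain (divResidue F D) := by
  have : Nontrivial (divResidue F D) :=
    Ideal.Quotient.nontrivial_iff.2 fun h => by
      have h1 : (1 : divRing F D) ∈ divRingMax F D := h ▸ trivial
      rw [mem_divRingMax, Subring.coe_one, divVal_one] at h1
      exact lt_irrefl _ h1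
  have : NoZeroDivisors (divResidue F D) := ⟨fun {a b} hab => by
    obtain ⟨x, rfl⟩ := Ideal.Quotient.mk_surjective a
    obtain ⟨y, rfl⟩ := Ideal.Quotient.mk_surjective b
    rw [← map_mul, Ideal.Quotient.eq_zero_iff_mem, mem_divRingMax, Subring.coe_mul,
      divVal_mul] at hab
    rw [Ideal.Quotient.eq_zero_iff_mem, Ideal.Quotient.eq_zero_iff_mem, mem_divRingMax,
      mem_divRingMax]
    by_contra! h
    exact absurd hab (not_lt.2 (one_le_mul h.1 h.2))⟩
  exact NoZeroDivisors.to_isDomain _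

variable {F D} in
lemma relIndex_divBall_eq_card {ϖ : Dˣ} (hϖ : IsDivUniformizer F ϖ) :
    (divBall F D (divVal F (ϖ : D))).relIndex (divBall F D 1) = Nat.card (divResidue F D) := by
  let f : divRing F D →+ D := (divRing F D).subtype.toAddMonoidHom
  have hf : f.range = divBall F D 1 := by
    ext x
    exact ⟨fun ⟨y, hy⟩ => hy ▸ y.2, fun hx => ⟨⟨x, hx⟩, rfl⟩⟩
  have hcomap : (divBall F D (divVal F (ϖ : D))).comap f =
      (divRingMax F D).toAddSubgroup := by
    ext x
    exact hϖ.lt_one_iff_le.symm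
  rw [← hf, ← AddSubgroup.index_comap, hcomap]
  rfl

variable {F D} in
/-- The ramification index of `D` over `F`. -/
lemma exists_ramification {ϖ : Dˣ} (hϖ : IsDivUniformizer F ϖ) {π : 𝒪[F]} (hπ : Irreducible π) :
    ∃ e : ℕ, divVal F (algebraMap F D π) = divVal F (ϖ : D) ^ e ∧
      Nat.card (divResidue F D) ^ e = Nat.card 𝓀[F] ^ Module.finrank F D := by
  have hπ0 : algebraMap F D π ≠ 0 :=
    (map_ne_zero _).2 fun h => hπ.ne_zero (Subtype.ext h)
  obtain ⟨e, he⟩ := hϖ.exists_eq_pow hπ0 (by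
    rw [divVal_algebraMap]
    exact pow_le_one₀ zero_le π.2)
  refine ⟨e, he, ?_⟩
  -- Both sides count `𝒪_D / π𝒪_D`: as `e` layers isomorphic to the residue ring, and as a lattice
  -- quotient.
  rw [← relIndex_divBall_irreducible hπ, he, relIndex_divBall_pow hϖ, relIndex_divBall_eq_card hϖ]

/-- An infinite type has `Nat.card` equal to `0`. Since `|π| < 1` forces `e ≠ 0`, the count would
read `0 = q ^ [D : F]`. -/
instance : Finite (divResidue F D) := by
  obtain ⟨ϖ, hϖ⟩ := exists_isDivUniformizer F D
  obtain ⟨π, hπ⟩ := IsDiscreteValuationRing.exists_irreducible 𝒪[F]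
  obtain ⟨e, he, h⟩ := exists_ramification hϖ hπ
  refine Nat.finite_of_card_ne_zero fun h0 => ?_
  have he0 : e ≠ 0 := by
    rintro rfl
    rw [pow_zero, divVal_algebraMap] at he
    exact ((pow_lt_one₀ zero_le (Valuation.Integer.not_isUnit_iff_valuation_lt_one.1 hπ.not_isUnit)
      Module.finrank_pos.ne').trans_eq he.symm).false
  rw [h0, zero_pow he0] at h
  exact pow_ne_zero _ Nat.card_pos.ne' h.symm

/-- Wedderburn's little theorem. Commutativity of this field is what puts commutators of units in
`U¹`. -/
noncomputable instance : Field (divResidue F D) := (Finite.isDomain_to_isField _).toField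

/-- The inclusion of the residue field of `F`. -/
noncomputable instance : Algebra 𝓀[F] (divResidue F D) :=
  (Ideal.Quotient.lift (IsLocalRing.maximalIdeal 𝒪[F])
    ((Ideal.Quotient.mk (divRingMax F D)).comp
      (((algebraMap F D).comp (𝒪[F]).subtype).codRestrict (divRing F D) fun a => by
        change divVal F (algebraMap F D a) ≤ 1
        rw [divVal_algebraMap]
        exact pow_le_one₀ zero_le a.2)) fun a ha => by
        refine Ideal.Quotient.eq_zero_iff_mem.2 (mem_divRingMax.2 ?_)
        change divVal F (algebraMap F D a) < 1
        rw [divVal_algebraMap]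
        exact pow_lt_one₀ zero_le (Valuation.Integer.not_isUnit_iff_valuation_lt_one.1
          ((IsLocalRing.mem_maximalIdeal _).1 ha)) Module.finrank_pos.ne').toAlgebra

end divResidue

end ResidueField

/-! ### Automorphisms of finite fields -/

section FiniteField

variable {k K : Type*} [Field k] [Field K] [Algebra k K] [Finite K]

lemma AlgEquiv.exists_eq_pow_natCard_pow (σ : K ≃ₐ[k] K) :
    ∃ r, 1 ≤ r ∧ r ≤ Module.finrank k K ∧ (∀ x, σ x = x ^ Nat.card k ^ r) ∧
      Nat.gcd (Module.finrank k K) r * orderOf σ = Module.finrank k K := by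
  have := Finite.of_injective _ (algebraMap k K).injective
  have := Fintype.ofFinite k
  have hpos : 0 < Module.finrank k K := Module.finrank_pos
  set φ := FiniteField.frobeniusAlgEquivOfAlgebraic k K
  have ho : orderOf φ = Module.finrank k K := FiniteField.orderOf_frobeniusAlgEquivOfAlgebraic k K
  obtain ⟨⟨i, hi⟩, rfl⟩ := (FiniteField.bijective_frobeniusAlgEquivOfAlgebraic_pow k K).2 σ
  have key : ∀ r, φ ^ r = φ ^ i → (∀ x, (φ ^ i) x = x ^ Nat.card k ^ r) ∧
      Nat.gcd (Module.finrank k K) r * orderOf (φ ^ i) = Module.finrank k K := by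
    intro r hr
    refine ⟨fun x => ?_, ?_⟩
    · rw [← hr, AlgEquiv.coe_pow, FiniteField.coe_frobeniusAlgEquivOfAlgebraic_iterate,
        Nat.card_eq_fintype_card]
    · rw [← hr, orderOf_pow, ho]
      exact Nat.mul_div_cancel' (Nat.gcd_dvd_left _ _)
  -- The identity is the power `[K : k]` of Frobenius rather than the power `0`, so that the
  -- exponent lies in `{1, …, [K : k]}`.
  rcases Nat.eq_zero_or_pos i with rfl | h
  · exact ⟨Module.finrank k K, hpos, le_rfl, key _ (by rw [← ho, pow_orderOf_eq_one, pow_zero])⟩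
  · exact ⟨i, h, hi.le, key i rfl⟩

/-- The fixed field of `⟨σ⟩` is `k`, so Galois theory gives `|⟨σ⟩| = [K : k]`. -/
lemma AlgEquiv.orderOf_eq_finrank (σ : K ≃ₐ[k] K)
    (hσ : ∀ x, σ x = x → x ∈ Set.range (algebraMap k K)) : orderOf σ = Module.finrank k K := by
  have hbot : IntermediateField.fixedField (Subgroup.zpowers σ) = ⊥ := by
    refine le_bot_iff.1 fun x hx => ?_
    obtain ⟨y, hy⟩ := hσ x (hx ⟨σ, Subgroup.mem_zpowers σ⟩)
    exact IntermediateField.mem_bot.2 ⟨y, hy⟩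
  rw [← Nat.card_zpowers, ← IntermediateField.finrank_fixedField_eq_card, hbot,
    IntermediateField.finrank_bot']

end FiniteField

/-! ### Conjugation on the residue field and Teichmüller representatives -/

section Residue

variable {F : Type*} [Field F] [ValuativeRel F] {D : Type*} [DivisionRing D] [Algebra F D]
  [FiniteDimensional F D] [TopologicalSpace F] [IsNonarchimedeanLocalField F]
  [TopologicalSpace D] [IsModuleTopology F D]

namespace divResidue

variable (F D) in
/-- The reduction map from the ring of integers of `D` to its residue field. -/
noncomputable abbrev mk : divRing F D →+* divResidue F D := Ideal.Quotient.mk (divRingMax F D)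

lemma mk_eq_zero_iff {x : divRing F D} : mk F D x = 0 ↔ divVal F (x : D) < 1 :=
  Ideal.Quotient.eq_zero_iff_mem

lemma mk_eq_mk_iff {x y : divRing F D} : mk F D x = mk F D y ↔ divVal F (x - y : D) < 1 := by
  rw [← sub_eq_zero, ← map_sub, mk_eq_zero_iff]
  rfl

lemma mk_ne_zero_iff {x : divRing F D} : mk F D x ≠ 0 ↔ divVal F (x : D) = 1 := by
  rw [Ne, mk_eq_zero_iff, not_lt]
  exact ⟨fun h => le_antisymm x.2 h, fun h => h.ge⟩

lemma algebraMap_residue (a : 𝒪[F]) (h : algebraMap F D a ∈ divRing F D) :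
    algebraMap 𝓀[F] (divResidue F D) (IsLocalRing.residue 𝒪[F] a) =
      mk F D ⟨algebraMap F D a, h⟩ := rfl

/-- Conjugation by an element of `Dˣ`, on the residue field of `D`. -/
noncomputable def conjHom (g : Dˣ) : divResidue F D →ₐ[𝓀[F]] divResidue F D where
  toRingHom := Ideal.quotientMap (divRingMax F D)
    ((((MulSemiringAction.toRingHom (ConjAct Dˣ) D (ConjAct.toConjAct g)).comp
      (divRing F D).subtype).codRestrict (divRing F D)) fun x => by
        change divVal F ((g : D) * x * ((g⁻¹ : Dˣ) : D)) ≤ 1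
        rw [divVal_conj]
        exact x.2) fun x hx => by
      change divVal F ((g : D) * x * ((g⁻¹ : Dˣ) : D)) < 1
      rw [divVal_conj]
      exact hx
  commutes' a := by
    obtain ⟨a, rfl⟩ := IsLocalRing.residue_surjective a
    refine congrArg (mk F D) (Subtype.ext ?_)
    change (g : D) * algebraMap F D a * ((g⁻¹ : Dˣ) : D) = algebraMap F D a
    rw [← Algebra.commutes, mul_assoc, Units.mul_inv, mul_one]

lemma conj_mem_divRing (g : Dˣ) (x : divRing F D) :
    (g : D) * x * ((g⁻¹ : Dˣ) : D) ∈ divRing F D := by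
  change divVal F ((g : D) * x * ((g⁻¹ : Dˣ) : D)) ≤ 1
  rw [divVal_conj]
  exact x.2

variable (F D) in
/-- The action of `Dˣ` on the residue field of `D` by conjugation. -/
noncomputable def conj : Dˣ →* (divResidue F D ≃ₐ[𝓀[F]] divResidue F D) :=
  (AlgEquiv.algHomUnitsEquiv _ _).toMonoidHom.comp (MonoidHom.toHomUnits
    { toFun := conjHom
      map_one' := by
        ext x
        obtain ⟨x, rfl⟩ := Ideal.Quotient.mk_surjective x
        refine congrArg (mk F D) (Subtype.ext ?_)
        change ((1 : Dˣ) : D) * x * ((1⁻¹ : Dˣ) : D) = x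
        simp
      map_mul' g h := by
        ext x
        obtain ⟨x, rfl⟩ := Ideal.Quotient.mk_surjective x
        refine congrArg (mk F D) (Subtype.ext ?_)
        change ((g * h : Dˣ) : D) * x * (((g * h)⁻¹ : Dˣ) : D) =
          g * (h * x * ((h⁻¹ : Dˣ) : D)) * ((g⁻¹ : Dˣ) : D)
        simp [mul_assoc] })

lemma conj_mk (g : Dˣ) (x : divRing F D) :
    conj F D g (mk F D x) = mk F D ⟨g * x * ((g⁻¹ : Dˣ) : D), conj_mem_divRing g x⟩ := rfl

lemma conj_eq_one {u : Dˣ} (hu : divVal F (u : D) = 1) : conj F D u = 1 := by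
  ext x
  obtain ⟨x, rfl⟩ := Ideal.Quotient.mk_surjective x
  have hu' : divVal F ((u⁻¹ : Dˣ) : D) = 1 := by rw [divVal_inv, hu, inv_one]
  change mk F D (⟨u, hu.le⟩ * x * ⟨((u⁻¹ : Dˣ) : D), hu'.le⟩) = mk F D x
  rw [map_mul, map_mul, mul_right_comm, ← map_mul]
  convert one_mul _
  rw [← map_one (mk F D)]
  exact congrArg _ (Subtype.ext u.mul_inv)

lemma conj_eq_one_of_commute {g : Dˣ} (hg : ∀ x : D, (g : D) * x = x * g) : conj F D g = 1 := by
  ext x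
  obtain ⟨x, rfl⟩ := Ideal.Quotient.mk_surjective x
  rw [conj_mk]
  refine congrArg _ (Subtype.ext ?_)
  change (g : D) * x * ((g⁻¹ : Dˣ) : D) = x
  rw [hg, mul_assoc, Units.mul_inv, mul_one]

/-- The two elements differ by a unit, which acts trivially because the residue field is
commutative. A uniformizer may thus be replaced by a better one. -/
lemma conj_eq_of_divVal_eq {ϖ ϖ' : Dˣ} (h : divVal F (ϖ : D) = divVal F (ϖ' : D)) :
    conj F D ϖ = conj F D ϖ' := by
  rw [← mul_inv_eq_one, ← map_inv, ← map_mul]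
  refine conj_eq_one ?_
  rw [Units.val_mul, divVal_mul, divVal_inv, h, mul_inv_cancel₀ (divVal_unit_ne_zero ϖ')]

lemma natCard_eq_pow_finrank :
    Nat.card (divResidue F D) = Nat.card 𝓀[F] ^ Module.finrank 𝓀[F] (divResidue F D) :=
  Module.natCard_eq_pow_finrank

lemma pow_natCard (x : divResidue F D) : x ^ Nat.card (divResidue F D) = x := by
  have := Fintype.ofFinite (divResidue F D)
  rw [Nat.card_eq_fintype_card, FiniteField.pow_card]

lemma natCard_cast_eq_zero : (Nat.card (divResidue F D) : divResidue F D) = 0 := by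
  have := Fintype.ofFinite (divResidue F D)
  rw [Nat.card_eq_fintype_card, Nat.cast_card_eq_zero]

end divResidue

open divResidue

/-- In `a^m - b^m = (a - b) ∑ a^i b^(m-1-i)`, the sum reduces to `m b^(m-1) = 0` because `a ≡ b`,
which gains a factor `|ϖ|`. It serves with `m` the residue cardinality and with `m = p`. -/
lemma IsDivUniformizer.divVal_pow_sub_pow_le {ϖ : Dˣ} (hϖ : IsDivUniformizer F ϖ)
    {a b : divRing F D} (hab : Commute a b) {m : ℕ} (hm : (m : divResidue F D) = 0) {j : ℕ}
    (h : divVal F (a - b : D) ≤ divVal F (ϖ : D) ^ (j + 1)) :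
    divVal F (a ^ m - b ^ m : D) ≤ divVal F (ϖ : D) ^ (j + 2) := by
  have hmk : mk F D a = mk F D b := mk_eq_mk_iff.2
    (h.trans_lt (pow_lt_one₀ zero_le hϖ.divVal_lt_one j.succ_ne_zero))
  have hS : divVal F ((∑ i ∈ Finset.range m, a ^ i * b ^ (m - 1 - i) : divRing F D) : D) ≤
      divVal F (ϖ : D) := by
    rw [← hϖ.lt_one_iff_le, ← mk_eq_zero_iff, map_sum]
    have : ∀ i ∈ Finset.range m, mk F D (a ^ i * b ^ (m - 1 - i)) = mk F D b ^ (m - 1) := by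
      intro i hi
      rw [map_mul, map_pow, map_pow, hmk, ← pow_add]
      congr 1
      have := Finset.mem_range.1 hi
      omega
    rw [Finset.sum_congr rfl this, Finset.sum_const, Finset.card_range, nsmul_eq_mul, hm, zero_mul]
  have hmul := congrArg (Subtype.val : divRing F D → D) (hab.mul_geom_sum₂ m)
  change (a - b : D) * _ = a ^ m - b ^ m at hmul
  rw [← hmul, divVal_mul, pow_succ]
  exact mul_le_mul' h hS

lemma divVal_pow_sub_pow_le (a b : divRing F D) {γ : ValueGroupWithZero F}
    (h : divVal F (a - b : D) ≤ γ) (m : ℕ) : divVal F (a ^ m - b ^ m : D) ≤ γ := by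
  induction m with
  | zero => simp [(divVal_eq_zero_iff F).2]
  | succ m ih =>
    have : (a ^ (m + 1) - b ^ (m + 1) : D) = a ^ m * (a - b) + (a ^ m - b ^ m) * b := by
      rw [pow_succ, pow_succ]; noncomm_ring
    rw [this]
    refine divVal_add_le F ?_ ?_
    · rw [divVal_mul, divVal_pow]
      exact (mul_le_of_le_one_left' (pow_le_one₀ zero_le a.2)).trans h
    · rw [divVal_mul]
      exact (mul_le_of_le_one_right' b.2).trans ih

/-- Teichmüller representatives. -/
lemma exists_pow_natCard_eq (a : divRing F D) :
    ∃ ω : divRing F D, ω ^ Nat.card (divResidue F D) = ω ∧ mk F D ω = mk F D a := by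
  obtain ⟨ϖ, hϖ⟩ := exists_isDivUniformizer F D
  have : IsTopologicalRing D := IsModuleTopology.isTopologicalRing F D
  set Q := Nat.card (divResidue F D)
  -- These powers form a Cauchy sequence whose limit is the Teichmüller lift; the limit is found
  -- below in an intersection of nested compact balls.
  let y : ℕ → divRing F D := fun k => a ^ Q ^ k
  have hy : ∀ k, divVal F (y (k + 1) - y k : D) ≤ divVal F (ϖ : D) ^ (k + 1) := by
    intro k
    induction k with
    | zero =>
      rw [zero_add, pow_one, ← hϖ.lt_one_iff_le, ← mk_eq_mk_iff]
      simp only [y, pow_one, pow_zero, map_pow]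
      exact pow_natCard _
    | succ k ih =>
      have h1 : ∀ k, y (k + 1) = y k ^ Q := fun k => by simp only [y, pow_succ, pow_mul]
      rw [h1 (k + 1)]
      nth_rewrite 2 [h1 k]
      exact hϖ.divVal_pow_sub_pow_le (((Commute.refl a).pow_left _).pow_right _)
        natCard_cast_eq_zero ih
  let T : ℕ → Set D := fun k => {z | divVal F (z - y k) ≤ divVal F (ϖ : D) ^ (k + 1)}
  have ht : divVal F (ϖ : D) ≤ 1 := hϖ.divVal_lt_one.le
  have hT : ∀ k z, z ∈ T k ↔ divVal F (z - (y k : D)) ≤ divVal F (ϖ : D) ^ (k + 1) :=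
    fun k z => Iff.rfl
  have hclosed : ∀ k, IsClosed (T k) := fun k =>
    (isClosed_setOf_divVal_le F (divVal F (ϖ : D) ^ (k + 1))).preimage
      (continuous_id.sub continuous_const : Continuous fun z : D => z - (y k : D))
  have hdec : ∀ k, T (k + 1) ⊆ T k := by
    intro k z hz
    rw [hT, ← sub_add_sub_cancel z (y (k + 1) : D)]
    exact divVal_add_le F (le_trans hz (pow_le_pow_of_le_one zero_le ht (Nat.le_succ _))) (hy k)
  have hne : ∀ k, (T k).Nonempty := fun k => ⟨y k, by
    rw [hT, sub_self, (divVal_eq_zero_iff F).2 rfl]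
    exact zero_le⟩
  have hsub : T 0 ⊆ divIntegers F D := by
    intro z hz
    change divVal F z ≤ 1
    rw [← sub_add_cancel z (y 0 : D)]
    exact divVal_add_le F (le_trans hz (pow_le_one₀ zero_le ht)) (y 0).2
  obtain ⟨ω, hω⟩ := IsCompact.nonempty_iInter_of_sequence_nonempty_isCompact_isClosed T hdec hne
    ((isCompact_divIntegers F D).of_isClosed_subset (hclosed 0) hsub) hclosed
  have hωT : ∀ k, divVal F (ω - y k) ≤ divVal F (ϖ : D) ^ (k + 1) := fun k =>
    Set.mem_iInter.1 hω k
  refine ⟨⟨ω, hsub (hωT 0)⟩, Subtype.ext (sub_eq_zero.1 (hϖ.eq_zero_of_forall_le fun k => ?_)), ?_⟩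
  · have h1 := divVal_pow_sub_pow_le ⟨ω, hsub (hωT 0)⟩ (y k) (hωT k) Q
    have h2 := hωT (k + 1)
    have h3 : (y (k + 1) : D) = (y k : D) ^ Q := by
      simp only [y, pow_succ, pow_mul, Subring.coe_pow]
    change divVal F (ω ^ Q - ω) ≤ _
    rw [← sub_sub_sub_cancel_right _ _ ((y k : D) ^ Q), sub_eq_add_neg]
    refine divVal_add_le F (h1.trans (pow_le_pow_of_le_one zero_le ht (Nat.le_succ _))) ?_
    rw [← h3]
    change divValuation F D _ ≤ _
    rw [Valuation.map_neg]
    exact h2.trans (pow_le_pow_of_le_one zero_le ht (by omega))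
  · have := hωT 0
    rw [zero_add, pow_one, ← hϖ.lt_one_iff_le] at this
    rw [mk_eq_mk_iff]
    simpa [y] using this

end Residue

/-! ### Generators of the division algebra -/

section Structure

variable (F : Type*) [Field F] [ValuativeRel F] (D : Type*) [DivisionRing D] [Algebra F D]
  [FiniteDimensional F D] [TopologicalSpace F] [IsNonarchimedeanLocalField F]
  [TopologicalSpace D] [IsModuleTopology F D]

open divResidue

/-- A root of unity of `D` that generates the unit group of the residue field. -/
lemma exists_teichmuller_generator : ∃ (ω : Dˣ) (h : divVal F (ω : D) = 1),
    ω ^ (Nat.card (divResidue F D) - 1) = 1 ∧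
      ∀ x : divResidue F D, x ≠ 0 → ∃ i : ℕ, x = mk F D ⟨ω, h.le⟩ ^ i := by
  obtain ⟨g, hg⟩ := IsCyclic.exists_generator (α := (divResidue F D)ˣ)
  obtain ⟨a, ha⟩ := Ideal.Quotient.mk_surjective (g : divResidue F D)
  obtain ⟨ω, hω, hωa⟩ := exists_pow_natCard_eq a
  have h1 : divVal F (ω : D) = 1 := by
    rw [← mk_ne_zero_iff, hωa, ha]
    exact g.ne_zero
  have h0 : (ω : D) ≠ 0 := fun h => by
    rw [h, (divVal_eq_zero_iff F).2 rfl] at h1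
    exact zero_ne_one h1
  refine ⟨Units.mk0 ω h0, h1, ?_, fun x hx => ?_⟩
  · have hpos : Nat.card (divResidue F D) - 1 + 1 = Nat.card (divResidue F D) :=
      Nat.sub_add_cancel Nat.card_pos
    refine mul_eq_right.1 (?_ : _ * Units.mk0 (ω : D) h0 = _)
    rw [← pow_succ, hpos]
    refine Units.ext ?_
    rw [Units.val_pow_eq_pow_val, Units.val_mk0, ← Subring.coe_pow, hω]
  · obtain ⟨i, hi⟩ := (mem_powers_iff_mem_zpowers.2 (hg (Units.mk0 x hx)) :)
    refine ⟨i, ?_⟩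
    have := congrArg Units.val hi
    rw [Units.val_mk0] at this
    rw [← this]
    change _ = mk F D ω ^ i
    rw [hωa, ha]
    exact Units.val_pow_eq_pow_val g i

variable {F D}

/-- An element of given valuation that normalizes the group generated by a root of unity. -/
lemma exists_divVal_eq_and_mul_eq_pow_mul {ϖ : Dˣ} {ω : Dˣ}
    (hω : divVal F (ω : D) = 1) (hω1 : ω ^ (Nat.card (divResidue F D) - 1) = 1) {T : ℕ}
    (hT : conj F D ϖ (mk F D ⟨ω, hω.le⟩) = mk F D ⟨ω, hω.le⟩ ^ T) :
    ∃ ϖ' : Dˣ, divVal F (ϖ' : D) = divVal F (ϖ : D) ∧ ϖ' * ω = ω ^ T * ϖ' := by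
  set m := Nat.card (divResidue F D) - 1 with hm
  have hval (i : ℕ) (g : Dˣ) (hg : divVal F (g : D) = 1) : divVal F ((g ^ i : Dˣ) : D) = 1 := by
    rw [Units.val_pow_eq_pow_val, divVal_pow, hg, one_pow]
  have hinv (g : Dˣ) (hg : divVal F (g : D) = 1) : divVal F ((g⁻¹ : Dˣ) : D) = 1 := by
    rw [divVal_inv, hg, inv_one]
  have hv : divVal F ((ϖ * ω * ϖ⁻¹ : Dˣ) : D) = 1 := by
    rw [Units.val_mul, Units.val_mul, divVal_conj, hω]
  -- Twisted average over `⟨ω⟩`: `c * ϖ = ∑ ω^(T i) ϖ ω^(-i)`, whose terms are cyclically permuted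
  -- by `z ↦ ω^T z ω⁻¹`. Each term of `c` reduces to `1`, so `c` reduces to `m = Q - 1 = -1`, with
  -- `Q` the residue cardinality, and is a unit.
  let c : divRing F D := ∑ i ∈ Finset.range m, ⟨((ω ^ T) ^ i : Dˣ), (hval _ _ (hval _ _ hω)).le⟩ *
    ⟨((ϖ * ω * ϖ⁻¹ : Dˣ)⁻¹ ^ i : Dˣ), (hval _ _ (hinv _ hv)).le⟩
  have hc : mk F D c = -1 := by
    have hterm : ∀ i ∈ Finset.range m, mk F D (⟨((ω ^ T) ^ i : Dˣ), (hval _ _ (hval _ _ hω)).le⟩ *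
        ⟨((ϖ * ω * ϖ⁻¹ : Dˣ)⁻¹ ^ i : Dˣ), (hval _ _ (hinv _ hv)).le⟩) = 1 := by
      intro i _
      have h1 : mk F D ⟨((ω ^ T) ^ i : Dˣ), (hval _ _ (hval _ _ hω)).le⟩ =
          mk F D ⟨((ϖ * ω * ϖ⁻¹ : Dˣ) ^ i : Dˣ), (hval _ _ hv).le⟩ := by
        have e1 : mk F D ⟨((ω ^ T) ^ i : Dˣ), (hval _ _ (hval _ _ hω)).le⟩ =
          (mk F D ⟨ω, hω.le⟩ ^ T) ^ i := by
          rw [← map_pow, ← map_pow]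
          exact congrArg _ (Subtype.ext (by simp))
        have e2 : mk F D ⟨((ϖ * ω * ϖ⁻¹ : Dˣ) ^ i : Dˣ), (hval _ _ hv).le⟩ =
            (conj F D ϖ (mk F D ⟨ω, hω.le⟩)) ^ i := by
          rw [conj_mk, ← map_pow]
          exact congrArg _ (Subtype.ext (Units.val_pow_eq_pow_val _ _))
        rw [e1, e2, hT]
      rw [map_mul, h1, ← map_mul, ← map_one (mk F D)]
      refine congrArg _ (Subtype.ext ?_)
      change (((ϖ * ω * ϖ⁻¹) ^ i : Dˣ) : D) * (((ϖ * ω * ϖ⁻¹)⁻¹ ^ i : Dˣ) : D) = 1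
      rw [inv_pow, Units.mul_inv]
    rw [map_sum, Finset.sum_congr rfl hterm, Finset.sum_const, Finset.card_range, nsmul_one,
      hm, Nat.cast_sub Nat.card_pos, natCard_cast_eq_zero, Nat.cast_one, zero_sub]
  have hc1 : divVal F (c : D) = 1 := by
    rw [← mk_ne_zero_iff, hc]
    exact neg_ne_zero.2 one_ne_zero
  have hcv : (c : D) * ϖ = ∑ i ∈ Finset.range m,
      (((ω ^ T) ^ i * ϖ * ω⁻¹ ^ i : Dˣ) : D) := by
    have : (c : D) = ∑ i ∈ Finset.range m,
      (((ω ^ T) ^ i * (ϖ * ω * ϖ⁻¹)⁻¹ ^ i : Dˣ) : D) :=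
      (map_sum (divRing F D).subtype _ _).trans (Finset.sum_congr rfl fun i _ => by simp)
    rw [this, Finset.sum_mul]
    refine Finset.sum_congr rfl fun i _ => ?_
    rw [← Units.val_mul]
    congr 1
    rw [inv_pow, conj_pow, inv_pow]
    group
  have hne : (c : D) * ϖ ≠ 0 := by
    rw [Ne, ← divVal_eq_zero_iff F, divVal_mul, hc1, one_mul]
    exact divVal_unit_ne_zero ϖ
  refine ⟨Units.mk0 _ hne, ?_, ?_⟩
  · rw [Units.val_mk0, divVal_mul, hc1, one_mul]
  · rw [eq_comm, ← mul_inv_eq_iff_eq_mul]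
    refine Units.ext ?_
    rw [Units.val_mul, Units.val_mul, Units.val_mk0, hcv, Finset.mul_sum, Finset.sum_mul]
    have hshift := (Finset.sum_range_succ' (fun i => (((ω ^ T) ^ i * ϖ * ω⁻¹ ^ i : Dˣ) : D)) m).symm.trans
      (Finset.sum_range_succ _ m)
    have hlast : (ω ^ T) ^ m * ϖ * ω⁻¹ ^ m = (ω ^ T) ^ 0 * ϖ * ω⁻¹ ^ 0 := by
      rw [← pow_mul, mul_comm, pow_mul, inv_pow, hω1]
      simp
    rw [hlast] at hshift
    refine Eq.trans (Finset.sum_congr rfl fun i _ => ?_) (add_right_cancel hshift)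
    rw [← Units.val_mul, ← Units.val_mul]
    congr 1
    rw [pow_succ', pow_succ]
    group

/-- An element that commutes with a uniformizer and with a root of unity that generates the
unit group of the residue field is central. -/
lemma IsDivUniformizer.commute_of_commute {ϖ : Dˣ} (hϖ : IsDivUniformizer F ϖ) {ω : Dˣ}
    (hω : divVal F (ω : D) = 1)
    (hgen : ∀ x : divResidue F D, x ≠ 0 → ∃ i : ℕ, x = mk F D ⟨ω, hω.le⟩ ^ i)
    {z : D} (hz1 : Commute (ϖ : D) z) (hz2 : Commute (ω : D) z) (x : D) : Commute x z := by
  -- Successive approximation by sums of products of powers of `ω` and `ϖ`, all of which commute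
  -- with `z`.
  have happrox : ∀ j : ℕ, ∀ x : D, divVal F x ≤ 1 →
      ∃ c : D, Commute c z ∧ divVal F (x - c) ≤ divVal F (ϖ : D) ^ j := by
    intro j
    induction j with
    | zero => exact fun x hx => ⟨0, Commute.zero_left z, by rwa [sub_zero, pow_zero]⟩
    | succ j ih =>
      have hlt : ∀ x : D, divVal F x < 1 →
          ∃ c : D, Commute c z ∧ divVal F (x - c) ≤ divVal F (ϖ : D) ^ (j + 1) := by
        intro x hx
        have hx' : divVal F (x * ((ϖ⁻¹ : Dˣ) : D)) ≤ 1 := by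
          rw [divVal_mul, divVal_inv, ← div_eq_mul_inv]
          exact div_le_one_of_le₀ (hϖ.lt_one_iff_le.1 hx) zero_le
        obtain ⟨c, hc, hxc⟩ := ih _ hx'
        refine ⟨c * ϖ, hc.mul_left hz1, ?_⟩
        have : x - c * ϖ = (x * ((ϖ⁻¹ : Dˣ) : D) - c) * ϖ := by
          rw [sub_mul, mul_assoc, Units.inv_mul, mul_one]
        rw [this, divVal_mul, pow_succ]
        exact mul_le_mul' hxc le_rfl
      intro x hx
      rcases hx.lt_or_eq with h | h
      · exact hlt x h
      · obtain ⟨i, hi⟩ := hgen (mk F D ⟨x, hx⟩) (mk_ne_zero_iff.2 h)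
        rw [← map_pow, mk_eq_mk_iff] at hi
        obtain ⟨c, hc, hxc⟩ := hlt _ hi
        refine ⟨ω ^ i + c, (hz2.pow_left i).add_left hc, ?_⟩
        rw [← sub_sub]
        exact hxc
  have hO : ∀ x : D, divVal F x ≤ 1 → Commute x z := by
    intro x hx
    by_cases hz0 : z = 0
    · rw [hz0]; exact Commute.zero_right x
    obtain ⟨n, hn⟩ := hϖ.exists_pow_le
      (inv_ne_zero fun h => hz0 ((divVal_eq_zero_iff F).1 h) : (divVal F z)⁻¹ ≠ 0)
    -- The extra precision `n` absorbs the size of `z` in `[x, z] = [x - c, z]`.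
    have hn' : divVal F (ϖ : D) ^ n * divVal F z ≤ 1 := by
      calc _ ≤ (divVal F z)⁻¹ * divVal F z := mul_le_mul' hn le_rfl
        _ = 1 := inv_mul_cancel₀ fun h => hz0 ((divVal_eq_zero_iff F).1 h)
    refine sub_eq_zero.1 (hϖ.eq_zero_of_forall_le fun j => ?_)
    obtain ⟨c, hc, hxc⟩ := happrox (j + n) x hx
    have hd : x * z - z * x = (x - c) * z + -(z * (x - c)) := by
      have := hc.eq
      rw [sub_mul, mul_sub, this]; abel
    have hle : divVal F (x - c) * divVal F z ≤ divVal F (ϖ : D) ^ j := by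
      calc _ ≤ divVal F (ϖ : D) ^ (j + n) * divVal F z := mul_le_mul' hxc le_rfl
        _ = divVal F (ϖ : D) ^ j * (divVal F (ϖ : D) ^ n * divVal F z) := by
          rw [pow_add, mul_assoc]
        _ ≤ _ := mul_le_of_le_one_right' hn'
    rw [hd]
    refine divVal_add_le F (by rwa [divVal_mul]) ?_
    change divValuation F D _ ≤ _
    rw [Valuation.map_neg, divValuation_apply, divVal_mul, mul_comm]
    exact hle
  by_cases hx0 : x = 0
  · rw [hx0]; exact Commute.zero_left z
  obtain ⟨n, hn⟩ := hϖ.exists_pow_le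
    (inv_ne_zero fun h => hx0 ((divVal_eq_zero_iff F).1 h) : (divVal F x)⁻¹ ≠ 0)
  have hxn : Commute (x * (ϖ : D) ^ n) z := hO _ (by
    rw [divVal_mul, divVal_pow]
    calc _ ≤ divVal F x * (divVal F x)⁻¹ := mul_le_mul' le_rfl hn
      _ = 1 := mul_inv_cancel₀ fun h => hx0 ((divVal_eq_zero_iff F).1 h))
  have hinv : Commute (((ϖ ^ n)⁻¹ : Dˣ) : D) z :=
    Commute.units_inv_left (by rw [Units.val_pow_eq_pow_val]; exact hz1.pow_left n)
  have := hxn.mul_left hinv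
  rwa [← Units.val_pow_eq_pow_val, mul_assoc, Units.mul_inv, mul_one] at this

end Structure

/-! ### Residue degree, ramification index and Hasse invariant -/

section Hasse

variable (F : Type*) [Field F] [ValuativeRel F] (D : Type*) [DivisionRing D] [Algebra F D]
  [FiniteDimensional F D] [TopologicalSpace F] [IsNonarchimedeanLocalField F]
  [TopologicalSpace D] [IsModuleTopology F D]

open divResidue

/-- A root of unity and a uniformizer that generate `D` over its center. -/
lemma exists_generators : ∃ (ω : Dˣ) (hω : divVal F (ω : D) = 1) (ϖ : Dˣ) (r : ℕ),
    IsDivUniformizer F ϖ ∧ ω ^ (Nat.card (divResidue F D) - 1) = 1 ∧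
    (∀ x : divResidue F D, x ≠ 0 → ∃ i : ℕ, x = mk F D ⟨ω, hω.le⟩ ^ i) ∧
    1 ≤ r ∧ r ≤ Module.finrank 𝓀[F] (divResidue F D) ∧
    (∀ x, conj F D ϖ x = x ^ Nat.card 𝓀[F] ^ r) ∧
    Nat.gcd (Module.finrank 𝓀[F] (divResidue F D)) r * orderOf (conj F D ϖ) =
      Module.finrank 𝓀[F] (divResidue F D) ∧
    ϖ * ω = ω ^ (Nat.card 𝓀[F] ^ r) * ϖ := by
  obtain ⟨ω, hω, hω1, hgen⟩ := exists_teichmuller_generator F D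
  obtain ⟨ϖ, hϖ⟩ := exists_isDivUniformizer F D
  obtain ⟨r, hr1, hr2, hr, hord⟩ := AlgEquiv.exists_eq_pow_natCard_pow (conj F D ϖ)
  obtain ⟨ϖ', h1, h2⟩ := exists_divVal_eq_and_mul_eq_pow_mul hω hω1 (hr (mk F D ⟨ω, hω.le⟩))
  have hconj := conj_eq_of_divVal_eq h1
  exact ⟨ω, hω, ϖ', r, hϖ.of_divVal_eq h1, hω1, hgen, hr1, hr2, hconj ▸ hr, hconj ▸ hord, h2⟩

/-- The residue field of `D` has degree `n` over that of `F`, and `D` has a Hasse invariant. -/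
lemma finrank_divResidue_and_exists_isHasseInvariant [Algebra.IsCentral F D] :
    Module.finrank 𝓀[F] (divResidue F D) = reducedDegree F D ∧ ∃ r, IsHasseInvariant F D r := by
  obtain ⟨ω, hω, ϖ, r, hϖ, hω1, hgen, hr1, hr2, hconj, hord, hωϖ⟩ := exists_generators F D
  set f := Module.finrank 𝓀[F] (divResidue F D) with hf
  set q := Nat.card 𝓀[F] with hq
  have hQ : Nat.card (divResidue F D) = q ^ f := natCard_eq_pow_finrank
  have hq1 : 1 < q := Finite.one_lt_card
  have hcentral : ∀ z : Dˣ, ϖ * z = z * ϖ → ω * z = z * ω → ∃ a : F, algebraMap F D a = z := by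
    intro z h1 h2
    have hz : (z : D) ∈ Subalgebra.center F D := Subalgebra.mem_center_iff.2 fun x =>
      hϖ.commute_of_commute hω hgen (congrArg Units.val h1) (congrArg Units.val h2) x
    exact Algebra.mem_bot.1 (Algebra.IsCentral.out hz)
  -- powers of `ω` are determined by their residues
  have hωinj : ∀ i j : ℕ, mk F D ⟨ω, hω.le⟩ ^ i = mk F D ⟨ω, hω.le⟩ ^ j → ω ^ i = ω ^ j := by
    have hb : mk F D ⟨ω, hω.le⟩ ≠ 0 := mk_ne_zero_iff.2 hω
    let b : (divResidue F D)ˣ := Units.mk0 _ hb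
    have hob : orderOf b = Nat.card (divResidue F D) - 1 := by
      rw [← Nat.card_units, orderOf_eq_card_of_forall_mem_powers]
      intro x
      obtain ⟨i, hi⟩ := hgen x x.ne_zero
      exact ⟨i, Units.ext (by rw [hi]; exact Units.val_pow_eq_pow_val b i)⟩
    intro i j hij
    have hb' : b ^ i = b ^ j := Units.ext (by
      rw [Units.val_pow_eq_pow_val, Units.val_pow_eq_pow_val]; exact hij)
    rw [pow_eq_pow_iff_modEq, hob] at hb'
    exact pow_eq_pow_iff_modEq.2 (hb'.of_dvd (orderOf_dvd_of_pow_eq_one hω1))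
  have hωpow : ∀ i, ϖ * ω ^ i = ω ^ (q ^ r * i) * ϖ := by
    intro i
    have : SemiconjBy ϖ ω (ω ^ q ^ r) := hωϖ
    rw [pow_mul]
    exact this.pow_right i
  -- If the residue of `ω^i` is fixed, then `ω^i` itself commutes with `ϖ`, since powers of `ω` are
  -- determined by their residues. It is then central, hence in `F`.
  have hfix : ∀ x, conj F D ϖ x = x → x ∈ Set.range (algebraMap 𝓀[F] (divResidue F D)) := by
    intro x hx
    by_cases hx0 : x = 0
    · exact ⟨0, by rw [map_zero, hx0]⟩
    obtain ⟨i, rfl⟩ := hgen x hx0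
    rw [hconj, ← pow_mul] at hx
    have h1 := hωinj _ _ hx
    obtain ⟨a, ha⟩ := hcentral (ω ^ i) (by rw [hωpow, mul_comm (q ^ r), h1])
      (by rw [← pow_succ, ← pow_succ'])
    have hval : divVal F (algebraMap F D a) = 1 := by
      rw [ha, Units.val_pow_eq_pow_val, divVal_pow, hω, one_pow]
    have ha1 : valuation F a ≤ 1 := by
      rw [divVal_algebraMap] at hval
      exact (pow_le_one_iff Module.finrank_pos.ne').1 hval.le
    refine ⟨IsLocalRing.residue 𝒪[F] ⟨a, ha1⟩, ?_⟩
    rw [algebraMap_residue _ hval.le, ← map_pow]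
    exact congrArg _ (Subtype.ext (ha.trans (Units.val_pow_eq_pow_val _ _)))
  have horder := AlgEquiv.orderOf_eq_finrank _ hfix
  rw [← hf] at horder
  have hfpos : 0 < f := Module.finrank_pos
  have hcop : Nat.gcd f r = 1 := by
    rw [horder] at hord
    exact Nat.eq_of_mul_eq_mul_right hfpos (by rw [hord, one_mul])
  obtain ⟨π, hπ⟩ := IsDiscreteValuationRing.exists_irreducible 𝒪[F]
  obtain ⟨e, he, hcard⟩ := exists_ramification hϖ hπ
  have hπ0 : algebraMap F D π ≠ 0 :=
    (map_ne_zero _).2 fun h => hπ.ne_zero (Subtype.ext h)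
  -- The central element `π` acts trivially and has the valuation of `ϖ^e`, while conjugation by `ϖ`
  -- has order `f`.
  have hfe : f ∣ e := by
    rw [← horder]
    refine orderOf_dvd_of_pow_eq_one ?_
    have h1 : conj F D (Units.mk0 _ hπ0) = 1 := conj_eq_one_of_commute fun x =>
      Algebra.commutes (π : F) x
    rw [← map_pow, ← h1]
    refine conj_eq_of_divVal_eq ?_
    rw [Units.val_pow_eq_pow_val, divVal_pow, Units.val_mk0, he]
  -- The power `ϖ^f` commutes with `ω`, since `q^(rf)` is the `r`-th power of the residue
  -- cardinality. So it lies in the maximal ideal of `𝒪_F`, where it is divisible by `π`.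
  have hef : e ≤ f := by
    have hiter : ∀ j i, ϖ ^ j * ω ^ i = ω ^ (q ^ (r * j) * i) * ϖ ^ j := by
      intro j
      induction j with
      | zero => intro i; simp
      | succ j ih =>
        intro i
        rw [pow_succ, mul_assoc, hωpow, ← mul_assoc, ih, mul_assoc, ← pow_succ,
          ← mul_assoc, ← pow_add]
        rw [mul_add_one]
    obtain ⟨a, ha⟩ := hcentral (ϖ ^ f) (by rw [← pow_succ, ← pow_succ']) (by
      have := hiter f 1
      have h1 : ω ^ (q ^ (r * f) * 1) = ω ^ 1 := by
        refine hωinj _ _ ?_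
        rw [mul_one, mul_comm, pow_mul, ← hQ, pow_one]
        generalize mk F D ⟨ω, hω.le⟩ = x
        clear * -
        induction r with
        | zero => rw [pow_zero, pow_one]
        | succ r ih => rw [pow_succ, pow_mul, ih, pow_natCard]
      rw [h1, pow_one] at this
      exact this.symm)
    have hval : divVal F (algebraMap F D a) = divVal F (ϖ : D) ^ f := by
      rw [ha, Units.val_pow_eq_pow_val, divVal_pow]
    have hval1 : divVal F (algebraMap F D a) < 1 := by
      rw [hval]
      exact pow_lt_one₀ zero_le hϖ.divVal_lt_one hfpos.ne'
    have ha1 : valuation F a < 1 := by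
      rw [divVal_algebraMap] at hval1
      exact (pow_lt_one_iff Module.finrank_pos.ne').1 hval1
    have hmem : (⟨a, ha1.le⟩ : 𝒪[F]) ∈ IsLocalRing.maximalIdeal 𝒪[F] :=
      (IsLocalRing.mem_maximalIdeal _).2 (Valuation.Integer.not_isUnit_iff_valuation_lt_one.2 ha1)
    rw [hπ.maximalIdeal_eq, Ideal.mem_span_singleton] at hmem
    obtain ⟨c, hc⟩ := hmem
    have hc' : a = π * c := congrArg Subtype.val hc
    have hle : divVal F (ϖ : D) ^ f ≤ divVal F (ϖ : D) ^ e := by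
      rw [← hval, hc', map_mul, divVal_mul, he]
      refine mul_le_of_le_one_right' ?_
      rw [divVal_algebraMap]
      exact pow_le_one₀ zero_le c.2
    by_contra! hlt
    exact absurd hle (not_le.2 (pow_lt_pow_right_of_lt_one₀ (divVal_unit_pos ϖ)
      hϖ.divVal_lt_one hlt))
  have hfe' : f ≤ e := by
    refine Nat.le_of_dvd (Nat.pos_of_ne_zero ?_) hfe
    rintro rfl
    rw [pow_zero] at hcard
    exact (Nat.one_lt_pow Module.finrank_pos.ne' hq1).ne hcard
  rw [le_antisymm hef hfe'] at hcard
  have hfinrank : Module.finrank F D = f * f := by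
    rw [hQ, ← pow_mul] at hcard
    exact (Nat.pow_right_injective hq1 hcard).symm
  have hn : f = reducedDegree F D := by
    rw [reducedDegree, hfinrank, Nat.sqrt_eq]
  refine ⟨hn, r, hr1, hn ▸ hr2, ?_, fun ϖ' hϖ' x hx => ?_⟩
  · rw [← hn]
    exact (Nat.gcd_comm _ _).trans hcop
  · have h1 := hconj (mk F D ⟨x, hx⟩)
    rw [← conj_eq_of_divVal_eq (hϖ'.divVal_eq hϖ), conj_mk, ← map_pow, mk_eq_mk_iff] at h1
    exact h1

lemma isHasseInvariant_hasseInvariant [Algebra.IsCentral F D] :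
    IsHasseInvariant F D (hasseInvariant F D) :=
  Nat.sInf_mem (finrank_divResidue_and_exists_isHasseInvariant F D).2

lemma natCard_divResidue [Algebra.IsCentral F D] :
    Nat.card (divResidue F D) = Nat.card 𝓀[F] ^ reducedDegree F D := by
  rw [natCard_eq_pow_finrank, (finrank_divResidue_and_exists_isHasseInvariant F D).1]

end Hasse

/-! ### The filtration by principal unit groups -/

section UnitFiltration

variable {F : Type*} [Field F] [ValuativeRel F] {D : Type*} [DivisionRing D] [Algebra F D]
  [FiniteDimensional F D] [TopologicalSpace F] [IsNonarchimedeanLocalField F]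
  [TopologicalSpace D] [IsModuleTopology F D]

open divResidue

lemma divVal_neg (x : D) : divVal F (-x) = divVal F x := Valuation.map_neg (divValuation F D) x

variable (F D) in
/-- The units `x` of the ring of integers of `D` with `|x - 1| ≤ γ`. -/
noncomputable def divUnits (γ : ValueGroupWithZero F) : Subgroup Dˣ where
  carrier := {x | divVal F (x : D) = 1 ∧ divVal F (x - 1 : D) ≤ γ}
  mul_mem' {x y} hx hy := by
    refine ⟨by rw [Units.val_mul, divVal_mul, hx.1, hy.1, one_mul], ?_⟩
    have : ((x * y : Dˣ) : D) - 1 = (x - 1) * y + (y - 1) := by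
      rw [Units.val_mul]; noncomm_ring
    rw [this]
    refine divVal_add_le F ?_ hy.2
    rw [divVal_mul, hy.1, mul_one]
    exact hx.2
  one_mem' := by
    refine ⟨divVal_one F, ?_⟩
    rw [Units.val_one, sub_self, (divVal_eq_zero_iff F).2 rfl]
    exact zero_le
  inv_mem' {x} hx := by
    have h1 : divVal F ((x⁻¹ : Dˣ) : D) = 1 := by rw [divVal_inv, hx.1, inv_one]
    refine ⟨h1, ?_⟩
    have : ((x⁻¹ : Dˣ) : D) - 1 = -(((x⁻¹ : Dˣ) : D) * (x - 1)) := by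
      rw [mul_sub, Units.inv_mul, mul_one, neg_sub]
    rw [this, divVal_neg, divVal_mul, h1, one_mul]
    exact hx.2

lemma mem_divUnits_one {x : Dˣ} : x ∈ divUnits F D 1 ↔ divVal F (x : D) = 1 :=
  ⟨fun h => h.1, fun h => ⟨h, by
    rw [sub_eq_add_neg]
    exact divVal_add_le F h.le (by rw [divVal_neg, divVal_one])⟩⟩

instance divUnits_normal (γ : ValueGroupWithZero F) : (divUnits F D γ).Normal where
  conj_mem x hx g := by
    refine ⟨by rw [Units.val_mul, Units.val_mul, divVal_conj, hx.1], ?_⟩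
    have : ((g * x * g⁻¹ : Dˣ) : D) - 1 = g * (x - 1) * ((g⁻¹ : Dˣ) : D) := by
      rw [mul_sub, sub_mul, mul_one, Units.mul_inv, Units.val_mul, Units.val_mul]
    rw [this, divVal_conj]
    exact hx.2

lemma divUnits_mono {γ δ : ValueGroupWithZero F} (h : γ ≤ δ) : divUnits F D γ ≤ divUnits F D δ :=
  fun _ hx => ⟨hx.1, hx.2.trans h⟩

namespace IsDivUniformizer

variable {ϖ : Dˣ} (hϖ : IsDivUniformizer F ϖ)
include hϖ

lemma isOpen_divUnits (j : ℕ) : IsOpen (divUnits F D (divVal F (ϖ : D) ^ j) : Set Dˣ) := by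
  have : IsTopologicalRing D := IsModuleTopology.isTopologicalRing F D
  have h1 : IsOpen {x : Dˣ | divVal F (x : D) ≤ 1} :=
    (isOpen_setOf_divVal_le F one_ne_zero).preimage Units.continuous_val
  -- By discreteness `|x| ≥ 1` is the negation of `|x| ≤ |ϖ|`, a closed condition.
  have h2 : IsOpen {x : Dˣ | ¬ divVal F (x : D) ≤ divVal F (ϖ : D)} :=
    ((isClosed_setOf_divVal_le F (divVal F (ϖ : D))).preimage Units.continuous_val).isOpen_compl
  have h3 : IsOpen {x : Dˣ | divVal F (x - 1 : D) ≤ divVal F (ϖ : D) ^ j} :=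
    (isOpen_setOf_divVal_le F (pow_ne_zero j (divVal_unit_ne_zero ϖ))).preimage
      (Units.continuous_val.sub continuous_const : Continuous fun x : Dˣ => (x - 1 : D))
  convert (h1.inter h2).inter h3 using 1
  ext x
  refine and_congr_left' ?_
  change _ ↔ _ ∧ ¬ _
  rw [← hϖ.lt_one_iff_le, not_lt, le_antisymm_iff]
  exact Iff.rfl

/-- The topology of `Dˣ` is induced by `x ↦ (x, x⁻¹)`, so both `x` and `x⁻¹` must be close to `1`;
the second follows because `divUnits` is a group. -/
lemma exists_divUnits_le (V : OpenSubgroup Dˣ) :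
    ∃ j : ℕ, divUnits F D (divVal F (ϖ : D) ^ j) ≤ V.toSubgroup := by
  have : IsTopologicalRing D := IsModuleTopology.isTopologicalRing F D
  have hV : (V : Set Dˣ) ∈ nhds 1 := V.mem_nhds_one
  rw [Units.isEmbedding_embedProduct.isInducing.nhds_eq_comap, Filter.mem_comap] at hV
  obtain ⟨W, hW, hWV⟩ := hV
  rw [map_one, Prod.one_eq_mk, nhds_prod_eq, Filter.mem_prod_iff] at hW
  obtain ⟨A, hA, B, hB, hAB⟩ := hW
  have hB' : MulOpposite.op ⁻¹' B ∈ nhds (1 : D) :=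
    MulOpposite.continuous_op.continuousAt.preimage_mem_nhds hB
  have hC : (fun x : D => 1 + x) ⁻¹' (A ∩ MulOpposite.op ⁻¹' B) ∈ nhds (0 : D) := by
    refine (continuous_const_add (1 : D)).continuousAt.preimage_mem_nhds ?_
    rw [add_zero]
    exact Filter.inter_mem hA hB'
  obtain ⟨j, hj⟩ := hϖ.exists_setOf_divVal_le_subset hC
  have key : ∀ x ∈ divUnits F D (divVal F (ϖ : D) ^ j), (x : D) ∈ A ∩ MulOpposite.op ⁻¹' B := by
    intro x hx
    have : (1 : D) + (x - 1) ∈ A ∩ MulOpposite.op ⁻¹' B := hj hx.2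
    rwa [add_sub_cancel] at this
  exact ⟨j, fun x hx => hWV (hAB ⟨(key x hx).1, (key _ (inv_mem hx)).2⟩)⟩

lemma commutator_mem_divUnits (j : ℕ) {x y : Dˣ} (hx : x ∈ divUnits F D (divVal F (ϖ : D) ^ j))
    (hy : y ∈ divUnits F D (divVal F (ϖ : D) ^ j)) :
    x * y * x⁻¹ * y⁻¹ ∈ divUnits F D (divVal F (ϖ : D) ^ (j + 1)) := by
  have hxy : divVal F ((x * y * x⁻¹ * y⁻¹ : Dˣ) : D) = 1 := by
    simp only [Units.val_mul, divVal_mul, divVal_inv, hx.1, hy.1, inv_one, mul_one]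
  refine ⟨hxy, ?_⟩
  have h1 : ((x * y * x⁻¹ * y⁻¹ : Dˣ) : D) - 1 =
      (x * y - y * x : D) * ((x⁻¹ * y⁻¹ : Dˣ) : D) := by
    have : (y * x : D) * ((x⁻¹ * y⁻¹ : Dˣ) : D) = 1 := by
      rw [← Units.val_mul, ← Units.val_mul]; simp
    rw [sub_mul, this, ← Units.val_mul, ← Units.val_mul, ← mul_assoc]
  rw [h1, divVal_mul, Units.val_mul, divVal_mul, divVal_inv, divVal_inv, hx.1, hy.1, inv_one,
    mul_one, mul_one]
  -- Level `0` uses commutativity of the residue field. From level `1` on, `xy - yx` is the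
  -- commutator of `x - 1` and `y - 1`, of size at most `|ϖ|^(2j)`, and `2j ≥ j + 1`.
  rcases j with _ | j
  · rw [zero_add, pow_one, ← hϖ.lt_one_iff_le]
    have := mk_eq_mk_iff.1 (mul_comm (mk F D ⟨x, hx.1.le⟩) (mk F D ⟨y, hy.1.le⟩))
    exact this
  · have h2 : (x * y - y * x : D) = (x - 1) * (y - 1) + -((y - 1) * (x - 1)) := by noncomm_ring
    have h3 : divVal F (ϖ : D) ^ (j + 1) * divVal F (ϖ : D) ^ (j + 1) ≤
        divVal F (ϖ : D) ^ (j + 1 + 1) := by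
      rw [← pow_add]
      exact pow_le_pow_of_le_one zero_le hϖ.divVal_lt_one.le (by omega)
    rw [h2]
    refine divVal_add_le F ?_ ?_
    · rw [divVal_mul]
      exact (mul_le_mul' hx.2 hy.2).trans h3
    · rw [divVal_neg, divVal_mul]
      exact (mul_le_mul' hy.2 hx.2).trans h3

lemma pow_mem_divUnits {p : ℕ} (hp : (p : divResidue F D) = 0) (j : ℕ) {x : Dˣ}
    (hx : x ∈ divUnits F D (divVal F (ϖ : D) ^ (j + 1))) :
    x ^ p ∈ divUnits F D (divVal F (ϖ : D) ^ (j + 2)) := by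
  refine ⟨by rw [Units.val_pow_eq_pow_val, divVal_pow, hx.1, one_pow], ?_⟩
  have := hϖ.divVal_pow_sub_pow_le (a := ⟨x, hx.1.le⟩) (b := 1) (Commute.one_right _) hp hx.2
  rwa [Subring.coe_one, one_pow, ← Units.val_pow_eq_pow_val] at this

/-- The normalized valuation of `D`. -/
noncomputable def ord : Dˣ →* Multiplicative ℤ where
  toFun x := Multiplicative.ofAdd (hϖ.exists_eq_zpow x).choose
  map_one' := congrArg Multiplicative.ofAdd (hϖ.zpow_strictAnti.injective (by
    change _ ^ (hϖ.exists_eq_zpow 1).choose = _ ^ (0 : ℤ)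
    rw [← (hϖ.exists_eq_zpow 1).choose_spec, Units.val_one, divVal_one, zpow_zero]))
  map_mul' x y := congrArg Multiplicative.ofAdd (hϖ.zpow_strictAnti.injective (by
    change _ ^ (hϖ.exists_eq_zpow (x * y)).choose =
      _ ^ ((hϖ.exists_eq_zpow x).choose + (hϖ.exists_eq_zpow y).choose)
    rw [zpow_add₀ (divVal_unit_ne_zero ϖ), ← (hϖ.exists_eq_zpow _).choose_spec,
      ← (hϖ.exists_eq_zpow x).choose_spec, ← (hϖ.exists_eq_zpow y).choose_spec, Units.val_mul,
      divVal_mul]))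

omit [TopologicalSpace D] [IsModuleTopology F D] in
lemma divVal_eq_zpow_ord (x : Dˣ) : divVal F (x : D) = divVal F (ϖ : D) ^ (hϖ.ord x).toAdd :=
  (hϖ.exists_eq_zpow x).choose_spec

omit [TopologicalSpace D] [IsModuleTopology F D] in
lemma ord_eq_iff {x : Dˣ} {i : ℤ} :
    hϖ.ord x = Multiplicative.ofAdd i ↔ divVal F (x : D) = divVal F (ϖ : D) ^ i := by
  rw [hϖ.divVal_eq_zpow_ord x, hϖ.zpow_strictAnti.injective.eq_iff]
  exact (Equiv.eq_symm_apply Multiplicative.toAdd).symm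

/-- The filtration of `Dˣ` by its principal unit groups. -/
noncomputable def unitFiltration {p : ℕ} (hp : (p : divResidue F D) = 0) :
    UnitFiltration Dˣ p where
  U j := divUnits F D (divVal F (ϖ : D) ^ j)
  normal _ := inferInstance
  isOpen := hϖ.isOpen_divUnits
  exists_le := hϖ.exists_divUnits_le
  commutator_mem j _ _ := hϖ.commutator_mem_divUnits j
  pow_mem j _ := hϖ.pow_mem_divUnits hp j
  ord := hϖ.ord
  mem_zero_iff x := by
    rw [pow_zero, mem_divUnits_one, ← ofAdd_zero, ord_eq_iff, zpow_zero]
  antitone _ _ h := divUnits_mono (pow_le_pow_of_le_one zero_le hϖ.divVal_lt_one.le h)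
  ϖ := ϖ
  ord_ϖ := by rw [ord_eq_iff, zpow_one]

end IsDivUniformizer

variable (F D) in
/-- The reduction map from the units of the ring of integers of `D` to those of its residue
field. -/
noncomputable def unitsReduction : divUnits F D 1 →* (divResidue F D)ˣ :=
  MonoidHom.toHomUnits
    { toFun := fun u => divResidue.mk F D ⟨(u : Dˣ), u.2.1.le⟩
      map_one' := rfl
      map_mul' := fun _ _ => rfl }

lemma coe_unitsReduction (u : divUnits F D 1) :
    (unitsReduction F D u : divResidue F D) = divResidue.mk F D ⟨(u : Dˣ), u.2.1.le⟩ := rfl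

lemma unitsReduction_surjective : Function.Surjective (unitsReduction F D) := by
  intro y
  obtain ⟨x, hx⟩ := Ideal.Quotient.mk_surjective (y : divResidue F D)
  have h1 : divVal F (x : D) = 1 := by
    rw [← mk_ne_zero_iff, hx]
    exact y.ne_zero
  have h0 : (x : D) ≠ 0 := fun h => by
    rw [h, (divVal_eq_zero_iff F).2 rfl] at h1
    exact zero_ne_one h1
  exact ⟨⟨Units.mk0 _ h0, mem_divUnits_one.2 h1⟩, Units.ext ((coe_unitsReduction _).trans hx)⟩

end UnitFiltration

/-! ### The theorem for the division algebra -/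

theorem proposition8p4
    -- a non-archimedean local field `F` and a central division `F`-algebra `D` of finite dimension,
    -- with its topology as a finite-dimensional `F`-vector space
    (F : Type*) [Field F] [ValuativeRel F] [TopologicalSpace F] [IsNonarchimedeanLocalField F]
    (D : Type*) [DivisionRing D] [Algebra F D] [Algebra.IsCentral F D] [FiniteDimensional F D]
    [TopologicalSpace D] [IsModuleTopology F D]
    -- a prime `ℓ` different from the residue characteristic, and an algebraic closure of `𝔽_ℓ`
    (ℓ : ℕ) [Fact ℓ.Prime] (hℓ : ℓ ≠ ringChar 𝓀[F])
    (k : Type*) [Field k] [Algebra (ZMod ℓ) k] [IsAlgClosure (ZMod ℓ) k] :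
    (¬ ℓ ∣ Nat.card 𝓀[F] ^ reducedDegree F D - 1 →
      {χ : SmoothCharacter k Dˣ | Nontrivial (Abelian.Ext
        (1 : SmoothCharacter k Dˣ).toSmoothRep χ.toSmoothRep 1)} = {1}) ∧
    (ℓ ∣ Nat.card 𝓀[F] ^ reducedDegree F D - 1 →
      ∃ χ_h : SmoothCharacter k Dˣ,
        (χ_h.IsUnramified F ∧ ∀ ϖ : Dˣ, IsDivUniformizer F ϖ →
          ((χ_h ϖ : kˣ) : k) = (Nat.card 𝓀[F] : k) ^ hasseInvariant F D) ∧
        {χ : SmoothCharacter k Dˣ | Nontrivial (Abelian.Ext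
          (1 : SmoothCharacter k Dˣ).toSmoothRep χ.toSmoothRep 1)} = {1, χ_h}) := by
  have : CharP k ℓ := charP_of_injective_algebraMap (algebraMap (ZMod ℓ) k).injective ℓ
  have : IsTopologicalRing D := IsModuleTopology.isTopologicalRing F D
  have hpp : (ringChar 𝓀[F]).Prime := CharP.char_is_prime 𝓀[F] _
  have hpκ : (ringChar 𝓀[F] : divResidue F D) = 0 := by
    rw [← map_natCast (algebraMap 𝓀[F] (divResidue F D)), CharP.cast_eq_zero, map_zero]
  have hpk : (ringChar 𝓀[F] : k) ≠ 0 := fun h =>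
    hℓ ((Nat.prime_dvd_prime_iff_eq Fact.out hpp).1 ((CharP.cast_eq_zero_iff k ℓ _).1 h))
  -- As a power of the residue characteristic, `q` is nonzero in `k`, so `q^h` can be the value of a
  -- character.
  have hq : (Nat.card 𝓀[F] : k) ≠ 0 := by
    have := Fintype.ofFinite 𝓀[F]
    obtain ⟨m, -, hm⟩ := FiniteField.card 𝓀[F] (ringChar 𝓀[F])
    rw [Nat.card_eq_fintype_card, hm, Nat.cast_pow]
    exact pow_ne_zero _ hpk
  obtain ⟨ϖ, hϖ⟩ := exists_isDivUniformizer F D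
  let U := hϖ.unitFiltration hpκ
  have hU0 : U.U 0 = divUnits F D 1 := congrArg (divUnits F D) (pow_zero _)
  let r : U.U 0 →* (divResidue F D)ˣ :=
    (unitsReduction F D).comp (MulEquiv.subgroupCongr hU0).toMonoidHom
  have hr : ∀ u : U.U 0, r u = 1 ↔ (u : Dˣ) ∈ U.U 1 := by
    intro u
    rw [← Units.val_inj]
    refine (divResidue.mk_eq_mk_iff (F := F) (D := D) (x := ⟨(u : Dˣ), u.2.1.le⟩)
      (y := 1)).trans ?_
    refine hϖ.lt_one_iff_le.trans ?_
    change _ ↔ _ ∧ divVal F _ ≤ _ ^ 1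
    rw [pow_one]
    exact ⟨fun h => ⟨u.2.1, h⟩, fun h => h.2⟩
  -- The defining congruence of the Hasse invariant, read on units of the residue field with `s =
  -- q^h`.
  have hs : ∀ u : U.U 0, ∃ h, r ⟨U.ϖ * u * U.ϖ⁻¹, h⟩ =
      r u ^ (Nat.card 𝓀[F] ^ hasseInvariant F D) := by
    intro u
    refine ⟨(U.normal 0).conj_mem _ u.2 _, Units.ext ?_⟩
    rw [Units.val_pow_eq_pow_val]
    refine Eq.trans ?_ (map_pow (divResidue.mk F D) ⟨(u : Dˣ), u.2.1.le⟩ _)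
    exact (divResidue.mk_eq_mk_iff (F := F) (D := D)
      (x := ⟨_, divResidue.conj_mem_divRing ϖ ⟨(u : Dˣ), u.2.1.le⟩⟩)).2
      ((isHasseInvariant_hasseInvariant F D).2.2.2 ϖ hϖ (u : Dˣ) u.2.1.le)
  have hsurj : Function.Surjective r :=
    unitsReduction_surjective.comp (MulEquiv.subgroupCongr hU0).surjective
  obtain ⟨h1, h2⟩ := U.setOf_nontrivial_ext hpk r hr hs hsurj ℓ
  rw [Nat.card_units, natCard_divResidue] at h1 h2
  refine ⟨h1, fun hdvd => ⟨U.unramifiedCharacter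
    (Units.mk0 ((Nat.card 𝓀[F] : k) ^ hasseInvariant F D) (pow_ne_zero _ hq)), ⟨?_, ?_⟩, ?_⟩⟩
  · exact fun x hx => U.unramifiedCharacter_of_mem _ (hU0.ge (mem_divUnits_one.2 hx))
  · intro ϖ' hϖ'
    have hord : U.ord ϖ' = Multiplicative.ofAdd 1 :=
      hϖ.ord_eq_iff.2 (by rw [zpow_one, hϖ'.divVal_eq hϖ])
    rw [U.unramifiedCharacter_apply, hord, toAdd_ofAdd, zpow_one, Units.val_mk0]
  · refine h2 hdvd _ (fun x hx => U.unramifiedCharacter_of_mem _ hx) ?_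
    rw [U.unramifiedCharacter_ϖ, Units.val_mk0, Nat.cast_pow]
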